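/- Let $K,U\ge 1$, and let $\mathcal A$ be the set of allocations $\mathbf a\in\{0,1,\dots,U\}^K$ of $U$ searchers to $K$ cells ($a_k=u$ means that cell $k$ is searched by searcher $u$, $a_k=0$ that it is unsearched) such that, for every $u\in[U]$, the set $\{k: a_k=u\}$ consists of consecutive cells. Let $\lambda_k\ge 0$ be arrival rates, $\omega_{ku}\in(0,1]$ baseline detection probabilities and $\phi_u:\mathcal A\to[0,1]$ scaling functions with $\phi_u(\mathbf a)>0$ whenever $a_k=u$ for some $k$. Put $\gamma_k(\mathbf a)=\sum_{u}\phi_u(\mathbf a)\,\omega_{ku}\,\mathbb I\{a_k=u\}$ and $\tau_{ku}=\omega_{ku}\lambda_k$. In each round $t=1,2,\dots$ a policy chooses an action $\mathbf a_t\in\mathcal A$ as a function of the past actions and observations; then, independently over cells and of the past given $\mathbf a_t$, $X_{kt}\sim\mathrm{Pois}(\lambda_k)$ events occur in cell $k$, and $Y_{kt}\mid X_{kt}\sim\mathrm{Bin}(X_{kt},\gamma_k(\mathbf a_t))$ are observed. Let $r(\mathbf a)=\sum_k\gamma_k(\mathbf a)\lambda_k$, $\mathrm{opt}=\max_{\mathbf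 a\in\mathcal A}r(\mathbf a)$, and let $\mathrm{Reg}(n)=n\cdot\mathrm{opt}-\mathbb E\big(\sum_{t=1}^n r(\mathbf a_t)\big)$ be the regret of the policy. Suppose the policy is FP-CUCB with a bound $\tau_{max}\ge\max_{k,u}\tau_{ku}$ and known $\phi_u$: the $KU$ pairs $ku\in[K]\times[U]$ are enumerated, and in round $t\le KU$ an arbitrary $\mathbf a\in\mathcal A$ is taken with $a_k=u$ for the $t$-th pair $ku$; in each round $t>KU$ an action (with ties broken arbitrarily) is taken that maximises $\sum_u\phi_u(\mathbf a)\sum_k\bar\tau_{ku,t}\,\mathbb I\{a_k=u\}$ over $\mathbf a\in\mathcal A$, where $$\bar\tau_{ku,t}=\frac{\sum_{s<t}Y_{ku,s}}{\sum_{s<t}\phi_{ku,s}}+\frac{2\log t}{\sum_{s<t}\phi_{ku,s}}+\sqrt{\frac{6\tau_{max}\log t}{\sum_{s<t}\phi_{ku,s}}},$$ $\phi_{ku,s}=\phi_u(\mathbf a_s)\,\mathbb I\{a_{k,s}=u\}$ and $Y_{ku,s}=Y_{ks}\,\mathbb I\{a_{k,s}=u\}$. For a pair $ku$ let $\Delta_{max}^{ku}$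 and $\Delta_{min}^{ku}$ be the largest and the smallest value of $\mathrm{opt}-r(\mathbf a)$ over the actions $\mathbf a\in\mathcal A$ with $a_k=u$ and $r(\mathbf a)\ne\mathrm{opt}$ (both $0$ if there are none). Let $\Delta_{max}=\max_{k,u}\Delta_{max}^{ku}$, $\phi_{ku,min}=\min_{\mathbf a\in\mathcal A:\,a_k=u}\phi_u(\mathbf a)$ and $\tilde b(x)=\tau_{max}+\sqrt{\tau_{max}^2+x^2/(9(KU)^2)}$. Then for every $n\ge 1$ $$\mathrm{Reg}(n)\le\sum_{ku:\,\Delta_{min}^{ku}>0}\frac{12(KU)^2}{\phi_{ku,min}}\left[\frac{\tilde b(\Delta_{min}^{ku})}{\Delta_{min}^{ku}}+\int_{\Delta_{min}^{ku}}^{\Delta_{max}^{ku}}\frac{\tilde b(x)}{x^2}\,dx\right]\log n+\left(\frac{\pi^2}{3}+1\right)KU\,\Delta_{max}.$$ -/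

import Mathlib

open scoped NNReal unitInterval

noncomputable section

/-- An allocation of searchers to cells: `a k = some u` means that cell `k` is searched by
searcher `u`, and `a k = none` that cell `k` goes unsearched. It is admissible if the set of cells
searched by any one searcher is an interval of consecutive cells. -/
def IsAdmissible {K U : ℕ} (a : Fin K → Option (Fin U)) : Prop :=
  ∀ (u : Fin U) (i j k : Fin K), i ≤ k → k ≤ j → a i = some u → a j = some u → a k = some u

/-- The action set. -/
abbrev SearchAction (K U : ℕ) : Type := {a : Fin K → Option (Fin U) // IsAdmissible a}

/-- An instance of the search problem with detection probabilities
`γ_k(a) = ∑_u φ_u(a) ω_{ku} 1{a_k = u}`. -/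
structure SearchProblem (K U : ℕ) where
  /-- the arrival rates `λ_k` -/
  rate : Fin K → ℝ≥0
  /-- the baseline detection probabilities `ω_{ku}` -/
  baseline : Fin K → Fin U → ℝ
  /-- the scaling functions `φ_u` -/
  scaling : Fin U → SearchAction K U → ℝ
  baseline_pos : ∀ k u, 0 < baseline k u
  baseline_le_one : ∀ k u, baseline k u ≤ 1
  scaling_nonneg : ∀ u a, 0 ≤ scaling u a
  scaling_le_one : ∀ u a, scaling u a ≤ 1
  /-- a searched cell has a non-zero detection probability -/
  scaling_pos : ∀ u (a : SearchAction K U) k, a.1 k = some u → 0 < scaling u a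

/-- The reward `∑_u φ_u(a) ∑_k τ_{ku} 1{a_k = u}` of an action in terms of a vector `τ` indexed by
cell-searcher pairs. -/
def pairReward {K U : ℕ} (τ : Fin K → Fin U → ℝ) (φ : Fin U → SearchAction K U → ℝ)
    (a : SearchAction K U) : ℝ :=
  ∑ u, φ u a * ∑ k, if a.1 k = some u then τ k u else 0

/-- A history: the list of the past rounds, most recent first, each round being recorded as the
action taken together with the numbers of events observed in the cells. -/
abbrev History (K U : ℕ) : Type := List (SearchAction K U × (Fin K → ℕ))

/-- A policy chooses the next action as a function of the history. -/
abbrev Policy (K U : ℕ) : Type := History K U → SearchAction K U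

/-- The law of the number of observed events in one cell: `X` is Poisson with mean `l`, and given
`X` the number of observed events is binomial with parameters `X` and `g`. -/
def cellLaw (l : ℝ≥0) (g : I) : PMF ℕ :=
  (ProbabilityTheory.poissonMeasure l).toPMF.bind fun x => (ProbabilityTheory.binomial x g).toPMF

namespace SearchProblem

variable {K U : ℕ} (P : SearchProblem K U)

/-- The detection probability `γ_k(a)`. -/
def detection (k : Fin K) (a : SearchAction K U) : ℝ :=
  ∑ u, P.scaling u a * P.baseline k u * if a.1 k = some u then 1 else 0

theorem detection_mem (k : Fin K) (a : SearchAction K U) : P.detection k a ∈ I := by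
  unfold detection
  cases h : a.1 k with
  | none => simp
  | some v =>
    have : ∀ u, (P.scaling u a * P.baseline k u * if (some v : Option (Fin U)) = some u then 1
        else 0) = if v = u then P.scaling u a * P.baseline k u else 0 := by
      intro u; simp
    simp only [this, Finset.sum_ite_eq, Finset.mem_univ, if_true]
    exact ⟨mul_nonneg (P.scaling_nonneg v a) (P.baseline_pos k v).le,
      mul_le_one₀ (P.scaling_le_one v a) (P.baseline_pos k v).le (P.baseline_le_one k v)⟩

/-- The unknown parameters `τ_{ku} = ω_{ku} λ_k`. -/
def tau (k : Fin K) (u : Fin U) : ℝ := P.baseline k u * P.rate k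

/-- The mean number `r(a) = γ(a)ᵀ λ` of events observed under the action `a`. -/
def reward (a : SearchAction K U) : ℝ := ∑ k, P.detection k a * P.rate k

/-- The largest mean reward of an action. -/
def opt : ℝ := ⨆ a : SearchAction K U, P.reward a

/-- The law of the vector of observed counts in one round in which the action `a` is taken; the
cells are independent. -/
def roundLaw (a : SearchAction K U) : PMF (Fin K → ℕ) :=
  (MeasureTheory.Measure.pi fun k =>
    (cellLaw (P.rate k) ⟨P.detection k a, P.detection_mem k a⟩).toMeasure).toPMF

/-- The law of the history of the first `n` rounds under the policy `π`. -/
def historyLaw (π : Policy K U) : ℕ → PMF (History K U)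
  | 0 => PMF.pure []
  | n + 1 => (historyLaw π n).bind fun h => (P.roundLaw (π h)).map fun y => (π h, y) :: h

/-- The expected total reward `E (∑_{t=1}^n r(a_t))` under the policy `π`. -/
def expectedReward (π : Policy K U) (n : ℕ) : ℝ :=
  ∑' h : History K U, (P.historyLaw π n h).toReal * (h.map fun x => P.reward x.1).sum

/-- The regret of the policy `π` over `n` rounds. -/
def regret (π : Policy K U) (n : ℕ) : ℝ := n * P.opt - P.expectedReward π n

/-- The suboptimal actions in which cell `k` is searched by searcher `u`. -/
def suboptimal (k : Fin K) (u : Fin U) : Set (SearchAction K U) :=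
  {a | P.reward a ≠ P.opt ∧ a.1 k = some u}

/-- `Δ_max^{ku}`, the largest gap `opt - r(a)` of a suboptimal action with `a_k = u`
(and `0` if there is no such action). -/
def gapMax (k : Fin K) (u : Fin U) : ℝ := ⨆ a : P.suboptimal k u, (P.opt - P.reward a)

/-- `Δ_min^{ku}`, the smallest gap `opt - r(a)` of a suboptimal action with `a_k = u`
(and `0` if there is no such action). -/
def gapMin (k : Fin K) (u : Fin U) : ℝ := ⨅ a : P.suboptimal k u, (P.opt - P.reward a)

/-- `Δ_max`, the maximum of the `Δ_max^{ku}`. -/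
def gapMaxAll : ℝ := ⨆ p : Fin K × Fin U, P.gapMax p.1 p.2

/-- `φ_{ku,min}`, the minimum of `φ_u(a)` over the (non-empty) set of actions with `a_k = u`. -/
def scalingMin (k : Fin K) (u : Fin U) : ℝ :=
  ⨅ a : {a : SearchAction K U // a.1 k = some u}, P.scaling u a.1

end SearchProblem

/-- The total `∑_s φ_{ku,s}` of the filtering probabilities applied to the pair `ku`. -/
def appliedScaling {K U : ℕ} (φ : Fin U → SearchAction K U → ℝ) (h : History K U)
    (k : Fin K) (u : Fin U) : ℝ :=
  (h.map fun x => if x.1.1 k = some u then φ u x.1 else 0).sum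

/-- The total `∑_s Y_{ku,s}` of the events observed in cell `k` by searcher `u`. -/
def observedCount {K U : ℕ} (h : History K U) (k : Fin K) (u : Fin U) : ℕ :=
  (h.map fun x => if x.1.1 k = some u then x.2 k else 0).sum

/-- The upper confidence index of the pair `ku` in round `t = h.length + 1`. -/
def ucbIndex {K U : ℕ} (φ : Fin U → SearchAction K U → ℝ) (τmax : ℝ) (h : History K U)
    (k : Fin K) (u : Fin U) : ℝ :=
  (observedCount h k u : ℝ) / appliedScaling φ h k u
    + 2 * Real.log ((h.length + 1 : ℕ) : ℝ) / appliedScaling φ h k u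
    + Real.sqrt (6 * τmax * Real.log ((h.length + 1 : ℕ) : ℝ) / appliedScaling φ h k u)

/-- `π` is an FP-CUCB policy with inputs `φ` and `τmax`. Here `e` enumerates the cell-searcher
pairs; in round `t ≤ KU` an arbitrary action is taken in which the cell of the `t`-th pair is
searched by the searcher of that pair, and in later rounds an action that maximises the reward
computed from the indices (ties being broken arbitrarily). -/
structure IsFPCUCB {K U : ℕ} (φ : Fin U → SearchAction K U → ℝ) (τmax : ℝ)
    (e : Fin (K * U) ≃ Fin K × Fin U) (π : Policy K U) : Prop where
  init : ∀ (h : History K U) (hh : h.length < K * U),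
    (π h).1 (e ⟨h.length, hh⟩).1 = some (e ⟨h.length, hh⟩).2
  iter : ∀ h : History K U, K * U ≤ h.length →
    ∀ a, pairReward (ucbIndex φ τmax h) φ a ≤ pairReward (ucbIndex φ τmax h) φ (π h)

/-- `b(x) = τmax + √(τmax² + x² / (9 (KU)²))`. -/
def bTilde (K U : ℕ) (τmax x : ℝ) : ℝ :=
  τmax + Real.sqrt (τmax ^ 2 + x ^ 2 / (9 * ((K : ℝ) * U) ^ 2))

end

/-! The regret is the expected sum of the gaps `opt - r(a_t)`. Three kinds of rounds are separated:
the first `KU`, the later ones in which the count of some pair deviates from its conditional mean,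
and the later ones without deviation. A round of the first two kinds costs at most `Δ_max`.

Probability of a deviation. Given the actions, the count `S` of a pair has mean `m = τ Φ`, where the
total scaling `Φ` is chosen adaptively and can take very many values, so a union bound over its
values is unsuitable. Instead, for each `θ` the two exponentials `exp (-θ S + (1 - e^{-θ}) m)` and
`exp (θ S - (e^θ - 1) m)` are martingales. Their averages, minus 1, are summed over a geometric grid
of `θ`, keeping only the points with `θ² m` at most a multiple of `L`. The resulting
`deviationPotential` is non-negative, grows in expectation by at most `6 + 1.26 L` per round, and is
at least `2 exp ((3 - 5/24) L)` at a deviation. Markov's inequality with `L = log t`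
(`historyLaw_expect_deviates_le`) then bounds the deviation probabilities of a pair by a series of
sum at most `π²/3` (`sum_rpow_le`).

Rounds without deviation. The indices exceed the `τ_{ku}` by little, so a suboptimal maximiser of
gap `Δ` must contain a pair with `Φ Δ² ≤ 24 (KU)² τmax log t` (`exists_pair_appliedScaling_le`). The
term `2 log t / Φ` of the index does not spoil this constant, because an action with a large gap has
a small total weight (`gap_le_mul`). The gap is charged to that pair. Each charge raises `Φ` by at
least `φ_{ku,min}`, and a layer-cake estimate (`chargeSum_le`) bounds the charged gaps. This gives
the stated main term even with `2 τmax` in place of `b̃`. -/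

open scoped ENNReal

/-! ### Expectations with values in `[0, ∞]` under a probability mass function. -/

/-- The expectation of a non-negative function under a probability mass function. -/
noncomputable def PMF.expect {α : Type*} (p : PMF α) (F : α → ℝ≥0∞) : ℝ≥0∞ := ∑' a, p a * F a

namespace PMF

variable {α β : Type*}

theorem expect_pure (a : α) (F : α → ℝ≥0∞) : (PMF.pure a).expect F = F a := by
  unfold expect
  rw [tsum_eq_single a (fun b hb => by simp [PMF.pure_apply, hb])]
  simp

theorem expect_bind (p : PMF α) (q : α → PMF β) (F : β → ℝ≥0∞) :
    (p.bind q).expect F = p.expect fun a => (q a).expect F := by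
  unfold expect
  simp only [PMF.bind_apply, ← ENNReal.tsum_mul_right, ← ENNReal.tsum_mul_left]
  rw [ENNReal.tsum_comm]
  simp only [mul_assoc]

theorem expect_map (p : PMF α) (g : α → β) (F : β → ℝ≥0∞) :
    (p.map g).expect F = p.expect (F ∘ g) := by
  rw [← PMF.bind_pure_comp, expect_bind]
  simp only [Function.comp_apply, expect_pure]
  rfl

theorem expect_add (p : PMF α) (F G : α → ℝ≥0∞) :
    (p.expect fun a => F a + G a) = p.expect F + p.expect G := by
  simp only [expect, mul_add, ENNReal.tsum_add]

theorem expect_const_mul (p : PMF α) (c : ℝ≥0∞) (F : α → ℝ≥0∞) :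
    (p.expect fun a => c * F a) = c * p.expect F := by
  simp only [expect, mul_left_comm _ c, ENNReal.tsum_mul_left]

theorem expect_const (p : PMF α) (c : ℝ≥0∞) : (p.expect fun _ => c) = c := by
  simp only [expect, ENNReal.tsum_mul_right, p.tsum_coe, one_mul]

theorem expect_finset_sum {ι : Type*} (p : PMF α) (s : Finset ι) (F : ι → α → ℝ≥0∞) :
    (p.expect fun a => ∑ i ∈ s, F i a) = ∑ i ∈ s, p.expect (F i) := by
  simp only [expect, Finset.mul_sum]
  exact Summable.tsum_finsetSum fun i _ => ENNReal.summable

theorem expect_mono (p : PMF α) {F G : α → ℝ≥0∞} (h : ∀ a, p a ≠ 0 → F a ≤ G a) :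
    p.expect F ≤ p.expect G := by
  refine ENNReal.tsum_le_tsum fun a => ?_
  by_cases ha : p a = 0
  · simp [ha]
  · exact mul_le_mul_right (h a ha) _

theorem expect_toPMF [Countable α] [MeasurableSpace α] [MeasurableSingletonClass α]
    (μ : MeasureTheory.Measure α) [MeasureTheory.IsProbabilityMeasure μ] (F : α → ℝ≥0∞) :
    μ.toPMF.expect F = ∫⁻ a, F a ∂μ := by
  rw [MeasureTheory.lintegral_countable', expect]
  simp only [MeasureTheory.Measure.toPMF_apply, mul_comm]

end PMF

/-! ### Exponential moments of thinned Poisson counts, and the law of the history. -/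

theorem binomial_expect_exp (x : ℕ) (g : I) (s : ℝ) :
    ((ProbabilityTheory.binomial x g).toPMF.expect fun y => ENNReal.ofReal (Real.exp (s * y)))
      = ENNReal.ofReal ((1 - g + g * Real.exp s) ^ x) := by
  have hg0 : (0 : ℝ) ≤ g := g.2.1
  have hg1 : (0 : ℝ) ≤ 1 - g := by linarith [g.2.2]
  unfold PMF.expect
  rw [tsum_eq_sum (s := Finset.range (x + 1))]
  · rw [add_comm (1 - (g : ℝ)), add_pow, ENNReal.ofReal_sum_of_nonneg (fun i _ => by positivity)]
    refine Finset.sum_congr rfl fun i _ => ?_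
    rw [MeasureTheory.Measure.toPMF_apply, ProbabilityTheory.binomial_singleton,
      ← ENNReal.ofReal_mul (by positivity), mul_comm s, Real.exp_nat_mul]
    congr 1
    ring
  · intro b hb
    have : x < b := by simpa using hb
    rw [MeasureTheory.Measure.toPMF_apply, ProbabilityTheory.binomial_singleton,
      Nat.choose_eq_zero_of_lt this]
    simp

theorem poisson_expect_pow (l : ℝ≥0) {z : ℝ} (hz : 0 ≤ z) :
    ((ProbabilityTheory.poissonMeasure l).toPMF.expect fun x => ENNReal.ofReal (z ^ x))
      = ENNReal.ofReal (Real.exp (l * (z - 1))) := by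
  have h : HasSum (fun n : ℕ => Real.exp (-l) * (l : ℝ) ^ n / n.factorial * z ^ n)
      (Real.exp (l * (z - 1))) := by
    have h1 := (NormedSpace.expSeries_div_hasSum_exp ((l : ℝ) * z)).mul_left (Real.exp (-l))
    rw [← Real.exp_eq_exp_ℝ, ← Real.exp_add, show -(l : ℝ) + l * z = l * (z - 1) by ring] at h1
    rwa [show (fun n : ℕ => Real.exp (-l) * ((l * z : ℝ) ^ n / n.factorial))
      = fun n : ℕ => Real.exp (-l) * (l : ℝ) ^ n / n.factorial * z ^ n from
        funext fun n => by rw [mul_pow]; ring] at h1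
  rw [← h.tsum_eq, ENNReal.ofReal_tsum_of_nonneg (fun n => by positivity) h.summable]
  refine tsum_congr fun n => ?_
  rw [MeasureTheory.Measure.toPMF_apply, ProbabilityTheory.poissonMeasure_singleton,
    ← ENNReal.ofReal_mul (by positivity)]

/-- The moment generating function of a thinned Poisson variable. -/
theorem cellLaw_expect_exp (l : ℝ≥0) (g : I) (s : ℝ) :
    ((cellLaw l g).expect fun y => ENNReal.ofReal (Real.exp (s * y)))
      = ENNReal.ofReal (Real.exp (l * g * (Real.exp s - 1))) := by
  have hg0 : (0 : ℝ) ≤ g := g.2.1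
  have hg1 : (0 : ℝ) ≤ 1 - g := by linarith [g.2.2]
  rw [cellLaw, PMF.expect_bind]
  simp only [binomial_expect_exp]
  rw [poisson_expect_pow l (by positivity)]
  congr 2
  ring

namespace SearchProblem

variable {K U : ℕ} (P : SearchProblem K U)

theorem roundLaw_expect_eval (a : SearchAction K U) (k : Fin K) (G : ℕ → ℝ≥0∞) :
    ((P.roundLaw a).expect fun y => G (y k))
      = (cellLaw (P.rate k) ⟨P.detection k a, P.detection_mem k a⟩).expect G := by
  rw [roundLaw, PMF.expect_toPMF]
  have hm := MeasureTheory.measurePreserving_eval (fun k =>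
    (cellLaw (P.rate k) ⟨P.detection k a, P.detection_mem k a⟩).toMeasure) k
  have := hm.lintegral_comp (f := G) (measurable_of_countable _)
  simp only [Function.eval] at this
  rw [this, ← PMF.expect_toPMF, PMF.toMeasure_toPMF]

theorem detection_of_eq {a : SearchAction K U} {k : Fin K} {u : Fin U} (h : a.1 k = some u) :
    P.detection k a = P.scaling u a * P.baseline k u := by
  unfold detection
  rw [Finset.sum_eq_single u]
  · simp [h]
  · intro v _ hv
    simp [h, Ne.symm hv]
  · simp

theorem roundLaw_expect_exp {a : SearchAction K U} {k : Fin K} {u : Fin U} (h : a.1 k = some u)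
    (s : ℝ) :
    ((P.roundLaw a).expect fun y => ENNReal.ofReal (Real.exp (s * y k)))
      = ENNReal.ofReal (Real.exp (P.tau k u * P.scaling u a * (Real.exp s - 1))) := by
  rw [P.roundLaw_expect_eval a k fun y => ENNReal.ofReal (Real.exp (s * y)), cellLaw_expect_exp]
  congr 2
  simp only [P.detection_of_eq h, tau]
  ring

theorem historyLaw_expect_succ (π : Policy K U) (n : ℕ) (F : History K U → ℝ≥0∞) :
    (P.historyLaw π (n + 1)).expect F
      = (P.historyLaw π n).expect fun h => (P.roundLaw (π h)).expect fun y => F ((π h, y) :: h) := by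
  rw [historyLaw, PMF.expect_bind]
  simp only [PMF.expect_map]
  rfl

/-- The histories that arise under a policy. -/
def _root_.History.FollowedBy (π : Policy K U) : History K U → Prop
  | [] => True
  | x :: h => x.1 = π h ∧ History.FollowedBy π h

theorem historyLaw_support (π : Policy K U) (n : ℕ) (h : History K U)
    (hh : P.historyLaw π n h ≠ 0) : h.length = n ∧ History.FollowedBy π h := by
  induction n generalizing h with
  | zero =>
    have : h = [] := by
      by_contra hne
      exact hh (by rw [historyLaw, PMF.pure_apply, if_neg hne])
    subst this
    exact ⟨rfl, trivial⟩
  | succ n ih =>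
    rw [← PMF.mem_support_iff, historyLaw, PMF.mem_support_bind_iff] at hh
    obtain ⟨h', hh', hm⟩ := hh
    rw [PMF.support_map] at hm
    obtain ⟨y, -, rfl⟩ := hm
    obtain ⟨h1, h2⟩ := ih h' ((PMF.mem_support_iff _ _).1 hh')
    exact ⟨by simp [h1], rfl, h2⟩

end SearchProblem

/-! ### The deviation potential of a Poisson count. -/

/-- The two-sided exponential martingale of a Poisson process with count `S` at mean `m`. -/
noncomputable def poissonMartingale (θ S m : ℝ) : ℝ :=
  (Real.exp (-θ * S + (1 - Real.exp (-θ)) * m) + Real.exp (θ * S - (Real.exp θ - 1) * m)) / 2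

theorem poissonMartingale_nonneg (θ S m : ℝ) : 0 ≤ poissonMartingale θ S m := by
  unfold poissonMartingale
  positivity

/-- The constant lies just above `cosh 1 - 1`, the extreme case `θ = 1`. -/
theorem exp_add_exp_neg_le {θ : ℝ} (h0 : 0 ≤ θ) (h1 : θ ≤ 1) :
    Real.exp θ + Real.exp (-θ) - 2 ≤ 2 * (0.5434 * θ ^ 2) := by
  have e1 := (abs_le.1 (Real.exp_bound (x := θ) (by rw [abs_of_nonneg h0]; exact h1)
    (n := 6) (by norm_num))).2
  have e2 := (abs_le.1 (Real.exp_bound (x := -θ) (by rw [abs_neg, abs_of_nonneg h0]; exact h1)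
    (n := 6) (by norm_num))).2
  rw [abs_neg] at e2
  rw [abs_of_nonneg h0] at e1 e2
  simp only [Finset.sum_range_succ, Finset.sum_range_zero, Nat.factorial] at e1 e2
  norm_num at e1 e2
  have h4 : θ ^ 4 ≤ θ ^ 2 := pow_le_pow_of_le_one h0 h1 (by norm_num)
  have h6 : θ ^ 6 ≤ θ ^ 2 := pow_le_pow_of_le_one h0 h1 (by norm_num)
  nlinarith [sq_nonneg θ]

theorem exp_sub_one_sub_le {θ : ℝ} (h0 : 0 ≤ θ) (h1 : θ ≤ 1) :
    Real.exp θ - 1 - θ ≤ θ ^ 2 / 2 + θ ^ 3 / 4 := by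
  have e1 := (abs_le.1 (Real.exp_bound (x := θ) (by rw [abs_of_nonneg h0]; exact h1)
    (n := 4) (by norm_num))).2
  rw [abs_of_nonneg h0] at e1
  simp only [Finset.sum_range_succ, Finset.sum_range_zero, Nat.factorial] at e1
  norm_num at e1
  have h4 : θ ^ 4 ≤ θ ^ 3 := pow_le_pow_of_le_one h0 h1 (by norm_num)
  have h3 : 0 ≤ θ ^ 3 := by positivity
  nlinarith

theorem exp_neg_sub_one_add_le {θ : ℝ} (h0 : 0 ≤ θ) (h1 : θ ≤ 1) :
    θ - (1 - Real.exp (-θ)) ≤ θ ^ 2 / 2 := by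
  have e1 := (abs_le.1 (Real.exp_bound (x := -θ) (by rw [abs_neg, abs_of_nonneg h0]; exact h1)
    (n := 4) (by norm_num))).2
  rw [abs_neg, abs_of_nonneg h0] at e1
  simp only [Finset.sum_range_succ, Finset.sum_range_zero, Nat.factorial] at e1
  norm_num at e1
  have h4 : θ ^ 4 ≤ θ ^ 3 := pow_le_pow_of_le_one h0 h1 (by norm_num)
  have h3 : 0 ≤ θ ^ 3 := by positivity
  nlinarith

/-- Bounding both exponentials below by their tangents at 0 makes the terms linear in `S` cancel;
this is what the two-sided average is for. -/
theorem one_sub_poissonMartingale_le {θ m : ℝ} (h0 : 0 ≤ θ) (h1 : θ ≤ 1) (S : ℝ) (hm : 0 ≤ m) :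
    1 - poissonMartingale θ S m ≤ min 1 (0.5434 * θ ^ 2 * m) := by
  refine le_min (by linarith [poissonMartingale_nonneg θ S m]) ?_
  unfold poissonMartingale
  have e1 := Real.add_one_le_exp (-θ * S + (1 - Real.exp (-θ)) * m)
  have e2 := Real.add_one_le_exp (θ * S - (Real.exp θ - 1) * m)
  have e3 := mul_le_mul_of_nonneg_right (exp_add_exp_neg_le h0 h1) hm
  nlinarith

/-- The geometric grid of exponents. -/
noncomputable def gridPoint (i : ℕ) : ℝ := (4 / 5) ^ i

theorem gridPoint_pos (i : ℕ) : 0 < gridPoint i := by unfold gridPoint; positivity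

theorem gridPoint_le_one (i : ℕ) : gridPoint i ≤ 1 :=
  pow_le_one₀ (by norm_num) (by norm_num)

theorem gridPoint_add (i j : ℕ) : gridPoint (i + j) = gridPoint i * (4 / 5) ^ j := by
  unfold gridPoint; rw [pow_add]

/-- The indices of the grid points that are relevant at mean `m`. -/
noncomputable def activeGrid (J : ℕ) (L m : ℝ) : Finset ℕ :=
  {i ∈ Finset.range J | gridPoint i ^ 2 * m ≤ 12.0984 * L}

theorem mem_activeGrid {J : ℕ} {L m : ℝ} {i : ℕ} :
    i ∈ activeGrid J L m ↔ i < J ∧ gridPoint i ^ 2 * m ≤ 12.0984 * L := by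
  simp [activeGrid]

theorem activeGrid_anti (J : ℕ) (L : ℝ) {m m' : ℝ} (h : m ≤ m') :
    activeGrid J L m' ⊆ activeGrid J L m := by
  intro i hi
  rw [mem_activeGrid] at hi ⊢
  exact ⟨hi.1, (mul_le_mul_of_nonneg_left h (sq_nonneg _)).trans hi.2⟩

/-- At most `6 - s` terms lie before `i₀ + 6`, each at most 1. The others form a geometric series of
ratio `16/25`, and `0.5434 · 12.0984 · (16/25)^6 · 25/9 < 1.26`. The threshold `12.0984 = 6 · 1.42²`
admits `θ` up to `1.42 √(6L/m)`. The bound does not depend on the number of grid points. -/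
theorem sum_grid_le {L m : ℝ} (hL : 0 ≤ L) (i₀ s : ℕ) (hs : s ≤ 6)
    (hi₀ : gridPoint i₀ ^ 2 * m ≤ 12.0984 * L) (A : Finset ℕ) (hA : ∀ i ∈ A, i₀ + s ≤ i) :
    ∑ i ∈ A, min 1 (0.5434 * gridPoint i ^ 2 * m) ≤ 6 - s + 1.26 * L := by
  classical
  rw [← Finset.sum_filter_add_sum_filter_not A (fun i => i < i₀ + 6)]
  refine add_le_add ?_ ?_
  · refine (Finset.sum_le_sum (g := fun _ => (1 : ℝ)) fun i _ => min_le_left _ _).trans ?_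
    have hsub : A.filter (fun i => i < i₀ + 6) ⊆ Finset.Ico (i₀ + s) (i₀ + 6) := by
      intro i hi
      rw [Finset.mem_filter] at hi
      exact Finset.mem_Ico.2 ⟨hA i hi.1, hi.2⟩
    have hc := Finset.card_le_card hsub
    rw [Nat.card_Ico, show i₀ + 6 - (i₀ + s) = 6 - s by omega] at hc
    rw [Finset.sum_const, nsmul_eq_mul, mul_one]
    calc ((A.filter (fun i => i < i₀ + 6)).card : ℝ) ≤ ((6 - s : ℕ) : ℝ) := by exact_mod_cast hc
      _ = 6 - s := by rw [Nat.cast_sub hs]; norm_num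
  · obtain ⟨N, hN⟩ : ∃ N, A ⊆ Finset.range N := A.exists_nat_subset_range
    have hsub : A.filter (fun i => ¬ i < i₀ + 6) ⊆ Finset.Ico (i₀ + 6) N := by
      intro i hi
      rw [Finset.mem_filter] at hi
      exact Finset.mem_Ico.2 ⟨not_lt.1 hi.2, Finset.mem_range.1 (hN hi.1)⟩
    have hpos : ∀ i : ℕ, 0 ≤ 0.5434 * (12.0984 * L) * ((16 / 25 : ℝ) ^ (i - i₀)) := fun i => by
      positivity
    calc ∑ i ∈ A.filter (fun i => ¬ i < i₀ + 6), min 1 (0.5434 * gridPoint i ^ 2 * m)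
        ≤ ∑ i ∈ A.filter (fun i => ¬ i < i₀ + 6),
            0.5434 * (12.0984 * L) * ((16 / 25 : ℝ) ^ (i - i₀)) := by
          refine Finset.sum_le_sum fun i hi => (min_le_right _ _).trans ?_
          rw [Finset.mem_filter] at hi
          obtain ⟨j, rfl⟩ : ∃ j, i = i₀ + j := ⟨i - i₀, by omega⟩
          rw [Nat.add_sub_cancel_left, gridPoint_add, mul_pow, ← pow_mul, mul_comm j 2, pow_mul]
          have := mul_le_mul_of_nonneg_right hi₀ (show (0 : ℝ) ≤ (16 / 25) ^ j by positivity)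
          norm_num
          nlinarith
      _ ≤ ∑ i ∈ Finset.Ico (i₀ + 6) N, 0.5434 * (12.0984 * L) * ((16 / 25 : ℝ) ^ (i - i₀)) :=
          Finset.sum_le_sum_of_subset_of_nonneg hsub fun i _ _ => hpos i
      _ = 0.5434 * (12.0984 * L) * (16 / 25) ^ 6
            * ∑ j ∈ Finset.range (N - (i₀ + 6)), (16 / 25 : ℝ) ^ j := by
          rw [Finset.sum_Ico_eq_sum_range, Finset.mul_sum]
          refine Finset.sum_congr rfl fun j _ => ?_
          rw [show i₀ + 6 + j - i₀ = 6 + j by omega, pow_add]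
          ring
      _ ≤ 0.5434 * (12.0984 * L) * (16 / 25) ^ 6 * (25 / 9) := by
          refine mul_le_mul_of_nonneg_left ?_ (by positivity)
          rw [geom_sum_eq (by norm_num)]
          have : (0 : ℝ) ≤ (16 / 25) ^ (N - (i₀ + 6)) := by positivity
          rw [div_le_iff_of_neg (by norm_num)]
          nlinarith
      _ ≤ 1.26 * L := by norm_num; nlinarith

theorem sum_activeGrid_le {L m : ℝ} (hL : 0 ≤ L) (J : ℕ) {A : Finset ℕ}
    (hA : A ⊆ activeGrid J L m) :
    ∑ i ∈ A, min 1 (0.5434 * gridPoint i ^ 2 * m) ≤ 6 + 1.26 * L := by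
  rcases A.eq_empty_or_nonempty with rfl | hne
  · simp; positivity
  · have h := sum_grid_le hL (A.min' hne) 0 (by norm_num)
      (mem_activeGrid.1 (hA (A.min'_mem hne))).2 A fun i hi => A.min'_le i hi
    simpa using h

/-- The non-negative potential that controls the deviation of a Poisson count `S` from its
mean `m` when the mean is increased adaptively. -/
noncomputable def deviationPotential (J : ℕ) (L S m : ℝ) : ℝ :=
  ∑ i ∈ activeGrid J L m, (poissonMartingale (gridPoint i) S m - 1) + (6 + 1.26 * L)

theorem neg_sum_poissonMartingale_le {m : ℝ} (S : ℝ) (hm : 0 ≤ m) (A : Finset ℕ) :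
    -∑ i ∈ A, (poissonMartingale (gridPoint i) S m - 1)
      ≤ ∑ i ∈ A, min 1 (0.5434 * gridPoint i ^ 2 * m) := by
  rw [← Finset.sum_neg_distrib]
  refine Finset.sum_le_sum fun i _ => ?_
  rw [neg_sub]
  exact one_sub_poissonMartingale_le (gridPoint_pos i).le (gridPoint_le_one i) S hm

theorem deviationPotential_nonneg (J : ℕ) {L m : ℝ} (hL : 0 ≤ L) (S : ℝ) (hm : 0 ≤ m) :
    0 ≤ deviationPotential J L S m := by
  unfold deviationPotential
  linarith [neg_sum_poissonMartingale_le S hm (activeGrid J L m),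
    sum_activeGrid_le hL J (Finset.Subset.refl (activeGrid J L m))]

/-- Grid points that become inactive as the mean grows may carry negative terms; removing these
raises the sum by at most `6 + 1.26 L`. -/
theorem sum_subset_le_deviationPotential (J : ℕ) {L m m' : ℝ} (hL : 0 ≤ L) (S : ℝ) (hm : 0 ≤ m)
    (hmm : m ≤ m') :
    ∑ i ∈ activeGrid J L m', (poissonMartingale (gridPoint i) S m - 1) + (6 + 1.26 * L)
      ≤ deviationPotential J L S m + (6 + 1.26 * L) := by
  unfold deviationPotential
  rw [← Finset.sum_sdiff (activeGrid_anti J L hmm)]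
  linarith [neg_sum_poissonMartingale_le S hm (activeGrid J L m \ activeGrid J L m'),
    sum_activeGrid_le hL J (Finset.sdiff_subset (s := activeGrid J L m) (t := activeGrid J L m'))]

theorem deviationPotential_zero (J : ℕ) (L : ℝ) : deviationPotential J L 0 0 = 6 + 1.26 * L := by
  simp [deviationPotential, poissonMartingale]

/-- Jensen's inequality, through the tangent to `exp` at `x`. -/
theorem four_mul_exp_le {E : ℕ → ℝ} {x : ℝ} (h : 4 * x ≤ ∑ i ∈ Finset.range 4, E i) :
    4 * Real.exp x ≤ ∑ i ∈ Finset.range 4, Real.exp (E i) := by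
  have key : ∀ i, Real.exp x * (1 + E i - x) ≤ Real.exp (E i) := fun i => by
    have := mul_le_mul_of_nonneg_left (Real.add_one_le_exp (E i - x)) (Real.exp_pos x).le
    rw [← Real.exp_add, add_sub_cancel] at this
    linarith
  refine le_trans ?_ (Finset.sum_le_sum fun i _ => key i)
  rw [← Finset.mul_sum]
  simp only [Finset.sum_range_succ, Finset.sum_range_zero] at h ⊢
  nlinarith [Real.exp_pos x]

/-- The count `S` deviates from its mean `m` at confidence level `exp (-3 L)`. -/
def Deviates (L S m : ℝ) : Prop :=
  2 * L + Real.sqrt (6 * m * L) < m - S ∨ 10 * L + Real.sqrt (6 * m * L) < S - m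

/-- A convex quadratic is largest at the endpoints, and `5/18` is nearly attained at both. Here
`1.136 = (4/5) · 1.42`, so one grid step covers the interval. -/
theorem sum_sq_grid_le {y : ℝ} (h1 : 1.136 ≤ y) (h2 : y ≤ 1.42) :
    (y - 1) ^ 2 + (y * (4 / 5) - 1) ^ 2 + (y * (4 / 5) ^ 2 - 1) ^ 2 + (y * (4 / 5) ^ 3 - 1) ^ 2
      ≤ 5 / 18 := by
  nlinarith [mul_nonneg (sub_nonneg.2 h1) (sub_nonneg.2 h2)]

/-- With `y = θ √m / √(6L)`, a deviation by `√(6mL)` makes the exponent at `θ` about `3L - 3L (y -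
1)²`. Four consecutive grid points, starting from the largest active one, surround the optimum `y =
1`, and averaging their exponents loses `3 · (5/18) / 4 = 5/24`. -/
theorem two_mul_exp_le_sum {L S m : ℝ} (hL : 0 < L) (hS : 0 ≤ S) (hm : 0 ≤ m)
    (hd : Deviates L S m) (i₀ : ℕ) (hi₀ : gridPoint i₀ ^ 2 * m ≤ 12.0984 * L)
    (hmin : ∀ i, i < i₀ → 12.0984 * L < gridPoint i ^ 2 * m) :
    2 * Real.exp ((3 - 5 / 24) * L)
      ≤ ∑ i ∈ Finset.range 4, poissonMartingale (gridPoint (i₀ + i)) S m := by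
  set a := Real.sqrt (6 * L) with ha
  set r := Real.sqrt m with hr
  have ha2 : a ^ 2 = 6 * L := Real.sq_sqrt (by positivity)
  have hr2 : r ^ 2 = m := Real.sq_sqrt hm
  have hapos : 0 < a := Real.sqrt_pos.2 (by positivity)
  have hr0 : 0 ≤ r := Real.sqrt_nonneg _
  have hw : Real.sqrt (6 * m * L) = a * r := by
    rw [show 6 * m * L = (6 * L) * m by ring, Real.sqrt_mul (by positivity)]
  set y := gridPoint i₀ * r / a with hy
  have hya : gridPoint i₀ * r = y * a := by rw [hy]; field_simp
  have hy0 : 0 ≤ y := by have := gridPoint_pos i₀; positivity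
  have hy2 : y ≤ 1.42 := by
    have h : (y * a) ^ 2 ≤ (1.42 * a) ^ 2 := by
      rw [← hya, mul_pow, hr2, mul_pow, ha2]; linarith
    have := abs_le_of_sq_le_sq h (by positivity)
    exact le_of_mul_le_mul_right ((le_abs_self _).trans this) hapos
  have hyi : ∀ i, gridPoint (i₀ + i) * r = y * (4 / 5) ^ i * a := fun i => by
    rw [gridPoint_add]; linear_combination (4 / 5) ^ i * hya
  -- For `i₀ > 0` the previous grid point has `y` multiplied by `5/4`, hence still below `1.42`,
  -- against the minimality of `i₀`.
  have hlow : y < 1.136 → i₀ = 0 := by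
    intro h
    by_contra hne
    have := hmin (i₀ - 1) (by omega)
    have hg : gridPoint i₀ = gridPoint (i₀ - 1) * (4 / 5) := by
      conv_lhs => rw [show i₀ = i₀ - 1 + 1 by omega, gridPoint_add]
      norm_num
    have h2 : gridPoint (i₀ - 1) * r = 5 / 4 * (y * a) := by rw [← hya, hg]; ring
    have h3 : gridPoint (i₀ - 1) ^ 2 * m = (5 / 4 * y) ^ 2 * (6 * L) := by
      rw [← hr2, ← mul_pow, h2, ← ha2]; ring
    have h4 : (5 / 4 * y) ^ 2 ≤ 2.0164 := by nlinarith
    nlinarith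
  obtain ⟨E, c, hc, hE, hEle⟩ : ∃ (E : ℕ → ℝ) (c : ℝ), (c = 0 ∧ 1.136 ≤ y ∨ c = 6.9) ∧
      (∀ i, Real.exp (E i) / 2 ≤ poissonMartingale (gridPoint (i₀ + i)) S m) ∧
      ∀ i, 3 * L - 3 * L * (y * (4 / 5) ^ i - 1) ^ 2 + c * L * gridPoint (i₀ + i) ≤ E i := by
    rcases hd with hd | hd
    · refine ⟨fun i => -gridPoint (i₀ + i) * S + (1 - Real.exp (-gridPoint (i₀ + i))) * m, 0,
        Or.inl ⟨rfl, ?_⟩, fun i => ?_, fun i => ?_⟩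
      -- Here `θ = 1` and `m = 6 L y²`: the mean is too small for `S ≥ 0` to fall short of it by `2L
      -- + √(6mL)`.
      · by_contra! h
        have h0 := hlow h
        rw [h0] at hya
        simp only [gridPoint, pow_zero, one_mul] at hya
        rw [hw, hya, ← hr2, hya] at hd
        have : (y * a) ^ 2 = y ^ 2 * (6 * L) := by rw [mul_pow, ha2]
        have h5 : a * (y * a) = y * (6 * L) := by rw [← ha2]; ring
        rw [this, h5] at hd
        have h6 : y ^ 2 - y ≤ 1 / 3 := by nlinarith
        have := mul_le_mul_of_nonneg_right h6 hL.le
        linarith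
      · unfold poissonMartingale
        gcongr
        exact le_add_of_nonneg_right (Real.exp_pos _).le
      · have hg := gridPoint_pos (i₀ + i)
        have e1 := mul_le_mul_of_nonneg_right
          (exp_neg_sub_one_add_le hg.le (gridPoint_le_one (i₀ + i))) hm
        have e2 := mul_lt_mul_of_pos_left hd hg
        have e3 : gridPoint (i₀ + i) * Real.sqrt (6 * m * L) = y * (4 / 5) ^ i * (6 * L) := by
          rw [hw, ← ha2]; linear_combination a * hyi i
        have e4 : gridPoint (i₀ + i) ^ 2 * m = (y * (4 / 5) ^ i) ^ 2 * (6 * L) := by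
          rw [← hr2, ← mul_pow, hyi i, ← ha2]; ring
        simp only
        nlinarith [mul_pos hg hL]
    -- Of the `10 L θ` supplied by the deviation, the cubic remainder `θ³ m / 4` uses at most
    -- `12.0984 / 4 · L θ`, which leaves more than `6.9 L θ`.
    · refine ⟨fun i => gridPoint (i₀ + i) * S - (Real.exp (gridPoint (i₀ + i)) - 1) * m, 6.9,
        Or.inr rfl, fun i => ?_, fun i => ?_⟩
      · unfold poissonMartingale
        gcongr
        exact le_add_of_nonneg_left (Real.exp_pos _).le
      · have hg := gridPoint_pos (i₀ + i)
        have e1 := mul_le_mul_of_nonneg_right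
          (exp_sub_one_sub_le hg.le (gridPoint_le_one (i₀ + i))) hm
        have e2 := mul_lt_mul_of_pos_left hd hg
        have e3 : gridPoint (i₀ + i) * Real.sqrt (6 * m * L) = y * (4 / 5) ^ i * (6 * L) := by
          rw [hw, ← ha2]; linear_combination a * hyi i
        have e4 : gridPoint (i₀ + i) ^ 2 * m = (y * (4 / 5) ^ i) ^ 2 * (6 * L) := by
          rw [← hr2, ← mul_pow, hyi i, ← ha2]; ring
        have e5 : gridPoint (i₀ + i) ^ 2 * m ≤ 12.0984 * L := by
          refine le_trans ?_ hi₀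
          rw [gridPoint_add]
          refine mul_le_mul_of_nonneg_right ?_ hm
          have := gridPoint_pos i₀
          exact pow_le_pow_left₀ (by positivity)
            (mul_le_of_le_one_right this.le (pow_le_one₀ (by norm_num) (by norm_num))) 2
        have e6 := mul_le_mul_of_nonneg_left e5 hg.le
        simp only
        nlinarith [mul_pos hg hL]
  have hsum : 4 * ((3 - 5 / 24) * L) ≤ ∑ i ∈ Finset.range 4, E i := by
    refine le_trans ?_ (Finset.sum_le_sum fun i _ => hEle i)
    simp only [Finset.sum_range_succ, Finset.sum_range_zero, pow_zero, pow_one, mul_one]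
    by_cases hy1 : 1.136 ≤ y
    · have hs := mul_le_mul_of_nonneg_left (sum_sq_grid_le hy1 hy2) hL.le
      have hc0 : 0 ≤ c := by rcases hc with ⟨h, -⟩ | h <;> rw [h]; norm_num
      have hp : ∀ i, 0 ≤ c * L * gridPoint (i₀ + i) := fun i =>
        mul_nonneg (mul_nonneg hc0 hL.le) (gridPoint_pos _).le
      have := hp 0; have := hp 1; have := hp 2; have := hp 3
      linarith
    -- The grid points are `1, 4/5, 16/25, 64/125`, and the linear terms `6.9 L θ` suffice by
    -- themselves.
    · have hc' : c = 6.9 := by tauto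
      have h0 := hlow (not_le.1 hy1)
      have hp : ∀ i, (y * (4 / 5) ^ i - 1) ^ 2 ≤ 1 := fun i => by
        have h1 : y * (4 / 5) ^ i ≤ y :=
          mul_le_of_le_one_right hy0 (pow_le_one₀ (by norm_num) (by norm_num))
        have h2 : 0 ≤ y * (4 / 5) ^ i := by positivity
        nlinarith
      have p0 := mul_le_mul_of_nonneg_left (hp 0) hL.le
      have p1 := mul_le_mul_of_nonneg_left (hp 1) hL.le
      have p2 := mul_le_mul_of_nonneg_left (hp 2) hL.le
      have p3 := mul_le_mul_of_nonneg_left (hp 3) hL.le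
      rw [hc', h0]
      simp only [gridPoint, pow_zero, pow_one, mul_one] at p0 p1 p2 p3 ⊢
      norm_num at p0 p1 p2 p3 ⊢
      linarith
  have := four_mul_exp_le hsum
  calc 2 * Real.exp ((3 - 5 / 24) * L) ≤ ∑ i ∈ Finset.range 4, Real.exp (E i) / 2 := by
        rw [← Finset.sum_div]; linarith
    _ ≤ _ := Finset.sum_le_sum fun i _ => hE i

/-- The constants cancel exactly: the four leading points contribute at least `2 exp ((3 - 5/24) L)
- 4`, the remaining ones at least `-(2 + 1.26 L)`, and the potential contains `6 + 1.26 L`. -/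
theorem two_mul_exp_le_deviationPotential {J j : ℕ} {L S m : ℝ} (hL : 0 < L) (hS : 0 ≤ S)
    (hm : 0 ≤ m) (hd : Deviates L S m) (hj : gridPoint j ^ 2 * m ≤ 12.0984 * L) (hJ : j + 4 ≤ J) :
    2 * Real.exp ((3 - 5 / 24) * L) ≤ deviationPotential J L S m := by
  classical
  have hex : ∃ i, gridPoint i ^ 2 * m ≤ 12.0984 * L := ⟨j, hj⟩
  set i₀ := Nat.find hex with hi₀def
  have hi₀ : gridPoint i₀ ^ 2 * m ≤ 12.0984 * L := Nat.find_spec hex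
  have hmin : ∀ i, i < i₀ → 12.0984 * L < gridPoint i ^ 2 * m := fun i hi =>
    not_le.1 (Nat.find_min hex hi)
  have hij : i₀ ≤ j := Nat.find_min' hex hj
  have h4 := two_mul_exp_le_sum hL hS hm hd i₀ hi₀ hmin
  have hsub : Finset.Ico i₀ (i₀ + 4) ⊆ activeGrid J L m := by
    intro i hi
    rw [Finset.mem_Ico] at hi
    refine mem_activeGrid.2 ⟨by omega, le_trans ?_ hi₀⟩
    have : gridPoint i ≤ gridPoint i₀ :=
      pow_le_pow_of_le_one (by norm_num) (by norm_num) hi.1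
    exact mul_le_mul_of_nonneg_right (pow_le_pow_left₀ (gridPoint_pos i).le this 2) hm
  have hrest := sum_grid_le hL.le i₀ 4 (by norm_num) hi₀
    (activeGrid J L m \ Finset.Ico i₀ (i₀ + 4)) (by
      intro i hi
      rw [Finset.mem_sdiff, mem_activeGrid, Finset.mem_Ico] at hi
      by_contra hlt
      have : i < i₀ := by by_contra h; exact hi.2 ⟨not_lt.1 h, not_le.1 hlt⟩
      exact absurd hi.1.2 (not_le.2 (hmin i this)))
  have hneg := neg_sum_poissonMartingale_le S hm (activeGrid J L m \ Finset.Ico i₀ (i₀ + 4))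
  unfold deviationPotential
  rw [← Finset.sum_sdiff hsub]
  have : ∑ i ∈ Finset.Ico i₀ (i₀ + 4), (poissonMartingale (gridPoint i) S m - 1)
      = ∑ i ∈ Finset.range 4, poissonMartingale (gridPoint (i₀ + i)) S m - 4 := by
    rw [Finset.sum_Ico_eq_sum_range, Nat.add_sub_cancel_left, Finset.sum_sub_distrib]
    norm_num
  push_cast at hrest
  linarith

/-! ### The deviation probability of a pair under a policy. -/

variable {K U : ℕ}

theorem appliedScaling_cons (φ : Fin U → SearchAction K U → ℝ)
    (x : SearchAction K U × (Fin K → ℕ)) (h : History K U) (k : Fin K) (u : Fin U) :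
    appliedScaling φ (x :: h) k u
      = (if x.1.1 k = some u then φ u x.1 else 0) + appliedScaling φ h k u := by
  simp [appliedScaling]

theorem observedCount_cons (x : SearchAction K U × (Fin K → ℕ)) (h : History K U) (k : Fin K)
    (u : Fin U) :
    observedCount (x :: h) k u
      = (if x.1.1 k = some u then x.2 k else 0) + observedCount h k u := by
  simp [observedCount]

namespace SearchProblem

variable (P : SearchProblem K U)

theorem tau_nonneg (k : Fin K) (u : Fin U) : 0 ≤ P.tau k u :=
  mul_nonneg (P.baseline_pos k u).le (P.rate k).2

theorem appliedScaling_nonneg (h : History K U) (k : Fin K) (u : Fin U) :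
    0 ≤ appliedScaling P.scaling h k u := by
  induction h with
  | nil => simp [appliedScaling]
  | cons x h ih =>
    rw [appliedScaling_cons]
    split_ifs
    · exact add_nonneg (P.scaling_nonneg u x.1) ih
    · simpa using ih

theorem appliedScaling_le_length (h : History K U) (k : Fin K) (u : Fin U) :
    appliedScaling P.scaling h k u ≤ h.length := by
  induction h with
  | nil => simp [appliedScaling]
  | cons x h ih =>
    rw [appliedScaling_cons, List.length_cons]
    push_cast
    split_ifs
    · linarith [P.scaling_le_one u x.1]
    · linarith

/-- The mean of the number of events that searcher `u` observes in cell `k`, given the actions. -/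
noncomputable def compensator (h : History K U) (k : Fin K) (u : Fin U) : ℝ :=
  P.tau k u * appliedScaling P.scaling h k u

theorem compensator_nonneg (h : History K U) (k : Fin K) (u : Fin U) :
    0 ≤ P.compensator h k u :=
  mul_nonneg (P.tau_nonneg k u) (P.appliedScaling_nonneg h k u)

theorem expect_poissonMartingale {a : SearchAction K U} {k : Fin K} {u : Fin U}
    (ha : a.1 k = some u) (θ S m : ℝ) :
    ((P.roundLaw a).expect fun y => ENNReal.ofReal
        (poissonMartingale θ (y k + S) (P.tau k u * P.scaling u a + m)))
      = ENNReal.ofReal (poissonMartingale θ S m) := by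
  set δ := P.tau k u * P.scaling u a with hδ
  have hsplit : ∀ y : Fin K → ℕ, ENNReal.ofReal (poissonMartingale θ (y k + S) (δ + m))
      = ENNReal.ofReal (Real.exp (-θ * S + (1 - Real.exp (-θ)) * (δ + m)) / 2)
          * ENNReal.ofReal (Real.exp (-θ * y k))
        + ENNReal.ofReal (Real.exp (θ * S - (Real.exp θ - 1) * (δ + m)) / 2)
          * ENNReal.ofReal (Real.exp (θ * y k)) := fun y => by
    rw [← ENNReal.ofReal_mul (by positivity), ← ENNReal.ofReal_mul (by positivity),
      ← ENNReal.ofReal_add (by positivity) (by positivity), div_mul_eq_mul_div,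
      div_mul_eq_mul_div, ← Real.exp_add, ← Real.exp_add, ← add_div]
    unfold poissonMartingale
    congr 4 <;> ring
  simp only [hsplit]
  rw [PMF.expect_add, PMF.expect_const_mul, PMF.expect_const_mul, P.roundLaw_expect_exp ha,
    P.roundLaw_expect_exp ha, ← ENNReal.ofReal_mul (by positivity),
    ← ENNReal.ofReal_mul (by positivity), ← ENNReal.ofReal_add (by positivity) (by positivity),
    div_mul_eq_mul_div, div_mul_eq_mul_div, ← Real.exp_add, ← Real.exp_add, ← add_div]
  unfold poissonMartingale
  congr 4 <;> ring

/-- The new mean, hence the new active set, is determined by the action. On that set the martingale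
terms keep their expectation, so only the removal of grid points costs. -/
theorem expect_deviationPotential_le (J : ℕ) {L : ℝ} (hL : 0 ≤ L) (h : History K U) (k : Fin K)
    (u : Fin U) (a : SearchAction K U) :
    ((P.roundLaw a).expect fun y => ENNReal.ofReal (deviationPotential J L
        (observedCount ((a, y) :: h) k u) (P.compensator ((a, y) :: h) k u)))
      ≤ ENNReal.ofReal (deviationPotential J L (observedCount h k u) (P.compensator h k u))
        + ENNReal.ofReal (6 + 1.26 * L) := by
  have hV : 0 ≤ 6 + 1.26 * L := by positivity
  simp only [compensator, observedCount_cons, appliedScaling_cons]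
  set S : ℝ := ((observedCount h k u : ℕ) : ℝ) with hS
  set m : ℝ := P.tau k u * appliedScaling P.scaling h k u with hm
  have hm0 : 0 ≤ m := P.compensator_nonneg h k u
  by_cases ha : a.1 k = some u
  · simp only [ha, if_true, mul_add, Nat.cast_add, ← hS, ← hm]
    set δ := P.tau k u * P.scaling u a with hδ
    have hδ0 : 0 ≤ δ := mul_nonneg (P.tau_nonneg k u) (P.scaling_nonneg u a)
    set A := activeGrid J L (δ + m) with hA
    have hf : ∀ S m : ℝ, 0 ≤ ∑ i ∈ A, poissonMartingale (gridPoint i) S m := fun S m =>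
      Finset.sum_nonneg fun i _ => poissonMartingale_nonneg _ _ _
    have hpot : ∀ S : ℝ, ENNReal.ofReal (deviationPotential J L S (δ + m)) + A.card
        = ∑ i ∈ A, ENNReal.ofReal (poissonMartingale (gridPoint i) S (δ + m))
          + ENNReal.ofReal (6 + 1.26 * L) := fun S => by
      rw [← ENNReal.ofReal_sum_of_nonneg fun i _ => poissonMartingale_nonneg _ _ _,
        ← ENNReal.ofReal_add (hf _ _) hV, ← ENNReal.ofReal_natCast,
        ← ENNReal.ofReal_add (deviationPotential_nonneg J hL S (by positivity))
          (Nat.cast_nonneg _)]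
      congr 1
      simp [deviationPotential, ← hA]
      ring
    -- Adding the number of active points to both sides removes the `-1` of each term, so that all
    -- terms are non-negative.
    refine ENNReal.le_of_add_le_add_right (ENNReal.natCast_ne_top A.card) ?_
    rw [← PMF.expect_const (P.roundLaw a) (A.card : ℝ≥0∞), ← PMF.expect_add]
    simp only [hpot]
    rw [PMF.expect_add, PMF.expect_finset_sum, PMF.expect_const, PMF.expect_const]
    simp only [hδ, P.expect_poissonMartingale ha]
    rw [← ENNReal.ofReal_sum_of_nonneg fun i _ => poissonMartingale_nonneg _ _ _,
      ← ENNReal.ofReal_add (hf _ _) hV, ← ENNReal.ofReal_natCast,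
      ← ENNReal.ofReal_add (deviationPotential_nonneg J hL S hm0) hV,
      ← ENNReal.ofReal_add (add_nonneg (deviationPotential_nonneg J hL S hm0) hV)
          (Nat.cast_nonneg _)]
    refine ENNReal.ofReal_le_ofReal ?_
    have := sum_subset_le_deviationPotential J hL S hm0 (show m ≤ δ + m by linarith)
    rw [← hA, Finset.sum_sub_distrib, Finset.sum_const, nsmul_eq_mul, mul_one] at this
    linarith
  · simp only [ha, if_false, zero_add, ← hS, ← hm]
    rw [PMF.expect_const]
    exact le_self_add

theorem historyLaw_expect_deviationPotential_le (π : Policy K U) (J : ℕ) {L : ℝ} (hL : 0 ≤ L)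
    (k : Fin K) (u : Fin U) (n : ℕ) :
    ((P.historyLaw π n).expect fun h => ENNReal.ofReal (deviationPotential J L
        (observedCount h k u) (P.compensator h k u)))
      ≤ (n + 1 : ℕ) * ENNReal.ofReal (6 + 1.26 * L) := by
  induction n with
  | zero =>
    rw [historyLaw, PMF.expect_pure]
    simp [observedCount, compensator, appliedScaling, deviationPotential_zero]
  | succ n ih =>
    rw [historyLaw_expect_succ]
    refine (PMF.expect_mono _ fun h _ => P.expect_deviationPotential_le J hL h k u (π h)).trans ?_
    rw [PMF.expect_add, PMF.expect_const, Nat.cast_succ (n + 1), add_mul, one_mul]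
    gcongr

open Classical in
/-- The probability that the count of a pair deviates from its mean after `n` rounds. -/
theorem historyLaw_expect_deviates_le (π : Policy K U) (k : Fin K) (u : Fin U) (n : ℕ) {L : ℝ}
    (hL : 0 < L) :
    ((P.historyLaw π n).expect fun h =>
        if Deviates L (observedCount h k u) (P.compensator h k u) then 1 else 0)
      ≤ ENNReal.ofReal ((n + 1 : ℕ) * (6 + 1.26 * L) / (2 * Real.exp ((3 - 5 / 24) * L))) := by
  -- After `n` rounds the mean is at most `τ n`, so a grid of `j + 4` points contains the four that
  -- are needed.
  obtain ⟨j, hj⟩ : ∃ j, gridPoint j ^ 2 * (P.tau k u * n) ≤ 12.0984 * L := by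
    have ht : Filter.Tendsto (fun j => gridPoint j ^ 2 * (P.tau k u * n)) Filter.atTop
        (nhds (0 ^ 2 * (P.tau k u * n))) :=
      ((tendsto_pow_atTop_nhds_zero_of_lt_one (by norm_num) (by norm_num)).pow 2).mul_const _
    obtain ⟨j, hj⟩ := (ht.eventually_lt_const (u := 12.0984 * L) (by simp; positivity)).exists
    exact ⟨j, hj.le⟩
  have hE := P.historyLaw_expect_deviationPotential_le π (j + 4) hL.le k u n
  set Q := 2 * Real.exp ((3 - 5 / 24) * L) with hQ
  have hQ0 : 0 < Q := by positivity
  have h1 : ENNReal.ofReal Q * ((P.historyLaw π n).expect fun h =>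
        if Deviates L (observedCount h k u) (P.compensator h k u) then 1 else 0)
      ≤ (n + 1 : ℕ) * ENNReal.ofReal (6 + 1.26 * L) := by
    rw [← PMF.expect_const_mul]
    refine (PMF.expect_mono _ fun h hh => ?_).trans hE
    split_ifs with hd
    · rw [mul_one]
      refine ENNReal.ofReal_le_ofReal (two_mul_exp_le_deviationPotential hL (Nat.cast_nonneg _)
        (P.compensator_nonneg h k u) hd (le_trans ?_ hj) le_rfl)
      refine mul_le_mul_of_nonneg_left ?_ (sq_nonneg _)
      refine mul_le_mul_of_nonneg_left ?_ (P.tau_nonneg k u)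
      rw [← (P.historyLaw_support π n h hh).1]
      exact P.appliedScaling_le_length h k u
    · simp
  rw [ENNReal.ofReal_div_of_pos hQ0, ENNReal.le_div_iff_mul_le
    (Or.inl (by simpa using hQ0)) (Or.inl ENNReal.ofReal_ne_top), mul_comm,
    ENNReal.ofReal_mul (Nat.cast_nonneg _), ENNReal.ofReal_natCast]
  exact h1

end SearchProblem

/-! ### Summing the deviation probabilities over time. -/

theorem deviation_bound_le (t : ℕ) (ht : 1 ≤ t) :
    (t : ℝ) * (6 + 1.26 * Real.log t) / (2 * Real.exp ((3 - 5 / 24) * Real.log t))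
      ≤ 3.45 * (t : ℝ) ^ (-(5 / 3) : ℝ) := by
  have ht0 : (0 : ℝ) < t := by exact_mod_cast ht
  have hL : 0 ≤ Real.log t := Real.log_nonneg (by exact_mod_cast ht)
  set L := Real.log t with hLdef
  rw [Real.rpow_def_of_pos ht0, ← hLdef, div_le_iff₀ (by positivity)]
  have e1 : 3.45 * Real.exp (L * -(5 / 3)) * (2 * Real.exp ((3 - 5 / 24) * L))
      = 6.9 * (t * Real.exp (L / 8)) := by
    rw [← Real.exp_log ht0, ← hLdef, ← Real.exp_add, show 3.45 * Real.exp (L * -(5 / 3))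
      * (2 * Real.exp ((3 - 5 / 24) * L)) = 6.9 * (Real.exp (L * -(5 / 3))
        * Real.exp ((3 - 5 / 24) * L)) by ring, ← Real.exp_add]
    congr 2
    ring
  -- Since `1 - (3 - 5/24) = -5/3 - 1/8`, a factor `t^{1/8} = e^{L/8}` is left to absorb the
  -- logarithm; its quadratic Taylor bound suffices.
  rw [e1, mul_left_comm]
  refine mul_le_mul_of_nonneg_left ?_ ht0.le
  have := Real.quadratic_le_exp_of_nonneg (x := L / 8) (by positivity)
  nlinarith [sq_nonneg (L - 3.7)]

/-- The comparison of `s^{-5/3}` with the integral of `x^{-5/3}` over `[s - 1, s]`, in a form that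
telescopes. -/
theorem rpow_neg_le_sub (t : ℕ) (ht : 2 ≤ t) :
    ((t + 1 : ℕ) : ℝ) ^ (-(5 / 3) : ℝ)
      ≤ 3 / 2 * ((t : ℝ) ^ (-(2 / 3) : ℝ) - ((t + 1 : ℕ) : ℝ) ^ (-(2 / 3) : ℝ)) := by
  have ht0 : (0 : ℝ) < t := by exact_mod_cast (by omega : 0 < t)
  have hs : (0 : ℝ) < ((t + 1 : ℕ) : ℝ) := by positivity
  set s : ℝ := ((t + 1 : ℕ) : ℝ) with hsdef
  have hts : (t : ℝ) = s - 1 := by simp [hsdef]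
  have e1 : s ^ (-(5 / 3) : ℝ) = s ^ (-(2 / 3) : ℝ) / s := by
    rw [show (-(5 / 3) : ℝ) = -(2 / 3) - 1 by norm_num, Real.rpow_sub_one hs.ne']
  have hlog : Real.log (t / s) ≤ t / s - 1 := Real.log_le_sub_one_of_pos (by positivity)
  have e2 : s ^ (-(2 / 3) : ℝ) * (1 + 2 / 3 / s) ≤ (t : ℝ) ^ (-(2 / 3) : ℝ) := by
    have : (t : ℝ) = s * (t / s) := by field_simp
    conv_rhs => rw [this]
    rw [Real.mul_rpow hs.le (by positivity)]
    refine mul_le_mul_of_nonneg_left ?_ (by positivity)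
    rw [Real.rpow_def_of_pos (by positivity)]
    refine le_trans ?_ (Real.add_one_le_exp _)
    have h3 : (t : ℝ) / s - 1 = -(1 / s) := by rw [hts]; field_simp; ring
    rw [h3] at hlog
    have h4 : 2 / 3 / s = 2 / 3 * (1 / s) := by ring
    rw [h4]
    linarith
  rw [e1]
  have : s ^ (-(2 / 3) : ℝ) * (1 + 2 / 3 / s)
    = s ^ (-(2 / 3) : ℝ) + 2 / 3 * (s ^ (-(2 / 3) : ℝ) / s) := by ring
  linarith

/-- The telescoped bound is `3.45 · (3/2) · 2^{-2/3}`, just below `π²/3`. It would be too large from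
`a = 1`, which is why `KU ≤ 1` is treated separately. -/
theorem sum_rpow_le (a b : ℕ) (ha : 2 ≤ a) :
    ∑ t ∈ Finset.Ico a b, 3.45 * ((t + 1 : ℕ) : ℝ) ^ (-(5 / 3) : ℝ) ≤ Real.pi ^ 2 / 3 := by
  have h1 : ∑ t ∈ Finset.Ico a b, ((t + 1 : ℕ) : ℝ) ^ (-(5 / 3) : ℝ)
      ≤ 3 / 2 * (a : ℝ) ^ (-(2 / 3) : ℝ) := by
    rcases le_or_gt b a with hab | hab
    · rw [Finset.Ico_eq_empty_of_le hab]
      simp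
      positivity
    · refine (Finset.sum_le_sum fun t ht => rpow_neg_le_sub t
        (ha.trans (Finset.mem_Ico.1 ht).1)).trans ?_
      rw [← Finset.mul_sum]
      refine mul_le_mul_of_nonneg_left ?_ (by norm_num)
      have := Finset.sum_Ico_sub (fun t : ℕ => -(t : ℝ) ^ (-(2 / 3) : ℝ)) hab.le
      have e : ∀ t : ℕ, (t : ℝ) ^ (-(2 / 3) : ℝ) - ((t + 1 : ℕ) : ℝ) ^ (-(2 / 3) : ℝ)
        = -((t + 1 : ℕ) : ℝ) ^ (-(2 / 3) : ℝ) - -(t : ℝ) ^ (-(2 / 3) : ℝ) := fun t => by ring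
      simp only [e]
      rw [this]
      have : 0 ≤ (b : ℝ) ^ (-(2 / 3) : ℝ) := by positivity
      linarith
  have h2 : (a : ℝ) ^ (-(2 / 3) : ℝ) ≤ 2 ^ (-(2 / 3) : ℝ) :=
    Real.rpow_le_rpow_of_nonpos (by norm_num) (by exact_mod_cast ha) (by norm_num)
  have h3 : (2 : ℝ) ^ (-(2 / 3) : ℝ) ≤ 0.632 := by
    have h0 : (0 : ℝ) ≤ 2 ^ (-(2 / 3) : ℝ) := by positivity
    refine le_of_pow_le_pow_left₀ (n := 3) (by norm_num) (by norm_num) ?_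
    rw [← Real.rpow_natCast, ← Real.rpow_mul (by norm_num)]
    norm_num
  rw [← Finset.mul_sum]
  nlinarith [Real.pi_gt_d2]

/-! ### Rewards, gaps and the optimism argument in rounds without deviation. -/

/-- The action in which only cell `k` is searched, by searcher `u`. -/
def singleAction (k : Fin K) (u : Fin U) : SearchAction K U :=
  ⟨fun j => if j = k then some u else none, by
    intro v i j l hil hlj hi hj
    have h1 : i = k := by by_contra h; simp [h] at hi
    have h2 : j = k := by by_contra h; simp [h] at hj
    have h3 : l = k := by
      exact le_antisymm (h2 ▸ hlj) (h1 ▸ hil)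
    simpa [h3, h1] using hi⟩

theorem singleAction_apply (k : Fin K) (u : Fin U) : (singleAction k u).1 k = some u := by
  simp [singleAction]

instance : Nonempty (SearchAction K U) := ⟨⟨fun _ => none, fun _ _ _ _ _ _ h => by simp at h⟩⟩

theorem pairReward_eq (τ : Fin K → Fin U → ℝ) (φ : Fin U → SearchAction K U → ℝ)
    (a : SearchAction K U) :
    pairReward τ φ a
      = ∑ p : Fin K × Fin U, if a.1 p.1 = some p.2 then φ p.2 a * τ p.1 p.2 else 0 := by
  rw [pairReward, Fintype.sum_prod_type_right]
  simp only [Finset.mul_sum, mul_ite, mul_zero]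

namespace SearchProblem

variable (P : SearchProblem K U)

theorem reward_eq_pairReward (a : SearchAction K U) :
    P.reward a = pairReward P.tau P.scaling a := by
  rw [pairReward_eq, Fintype.sum_prod_type, reward]
  refine Finset.sum_congr rfl fun k _ => ?_
  rw [detection, Finset.sum_mul]
  refine Finset.sum_congr rfl fun u _ => ?_
  split_ifs
  · rw [tau]; ring
  · ring

/-- The gap `opt - r(a)` of an action. -/
noncomputable def gap (a : SearchAction K U) : ℝ := P.opt - P.reward a

theorem gap_nonneg (a : SearchAction K U) : 0 ≤ P.gap a :=
  sub_nonneg.2 (le_ciSup (Set.finite_range P.reward).bddAbove a)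

theorem exists_reward_eq_opt : ∃ a, P.reward a = P.opt :=
  exists_eq_ciSup_of_finite

/-- The total scaling of the searched cells. -/
noncomputable def weight (a : SearchAction K U) : ℝ :=
  ∑ p : Fin K × Fin U, if a.1 p.1 = some p.2 then P.scaling p.2 a else 0

theorem weight_nonneg (a : SearchAction K U) : 0 ≤ P.weight a :=
  Finset.sum_nonneg fun p _ => by
    split_ifs
    exacts [P.scaling_nonneg _ _, le_rfl]

theorem weight_le (a : SearchAction K U) : P.weight a ≤ (K : ℝ) * U := by
  have h : P.weight a ≤ ∑ _p : Fin K × Fin U, (1 : ℝ) :=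
    Finset.sum_le_sum fun p _ => by
      split_ifs
      exacts [P.scaling_le_one _ _, zero_le_one]
  simpa using h

/-- Each pair adds at most `τ_{ku}` to the optimum, so an action of large weight has a small gap. -/
theorem gap_le_mul {τmax : ℝ} (hτ : ∀ k u, P.tau k u ≤ τmax) (a : SearchAction K U) :
    P.gap a ≤ τmax * ((K : ℝ) * U - P.weight a) := by
  obtain ⟨b, hb⟩ := P.exists_reward_eq_opt
  rw [gap, ← hb, P.reward_eq_pairReward, P.reward_eq_pairReward, pairReward_eq, pairReward_eq,
    ← Finset.sum_sub_distrib]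
  have h : (K : ℝ) * U - P.weight a
      = ∑ p : Fin K × Fin U, (1 - if a.1 p.1 = some p.2 then P.scaling p.2 a else 0) := by
    rw [Finset.sum_sub_distrib, weight]
    simp
  rw [h, Finset.mul_sum]
  refine Finset.sum_le_sum fun p _ => ?_
  have h0 := P.tau_nonneg p.1 p.2
  have h1 := hτ p.1 p.2
  have hb1 : (if b.1 p.1 = some p.2 then P.scaling p.2 b * P.tau p.1 p.2 else 0)
      ≤ P.tau p.1 p.2 := by
    split_ifs
    · exact mul_le_of_le_one_left h0 (P.scaling_le_one _ _)
    · exact h0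
  have ha1 := P.scaling_le_one p.2 a
  split_ifs at hb1 ⊢ <;> nlinarith

/-- The lower half of `Deviates`, divided by `Φ`, is dominated by the bonus of the index. In the
second bound, `12` is the `10` of the upper half plus the `2` of the bonus. -/
theorem tau_le_ucbIndex {τmax : ℝ} (hτ : ∀ k u, P.tau k u ≤ τmax) {h : History K U} {k : Fin K}
    {u : Fin U} (hΦ : 0 < appliedScaling P.scaling h k u)
    (hd : ¬ Deviates (Real.log ((h.length + 1 : ℕ) : ℝ)) (observedCount h k u)
      (P.compensator h k u)) :
    P.tau k u ≤ ucbIndex P.scaling τmax h k u ∧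
      ucbIndex P.scaling τmax h k u - P.tau k u
        ≤ 12 * (Real.log ((h.length + 1 : ℕ) : ℝ) / appliedScaling P.scaling h k u)
          + 2 * Real.sqrt (6 * τmax * Real.log ((h.length + 1 : ℕ) : ℝ)
              / appliedScaling P.scaling h k u) := by
  have hL : 0 ≤ Real.log ((h.length + 1 : ℕ) : ℝ) := Real.log_natCast_nonneg _
  rw [Deviates, not_or, not_lt, not_lt, compensator] at hd
  unfold ucbIndex
  set L := Real.log ((h.length + 1 : ℕ) : ℝ)
  set Φ := appliedScaling P.scaling h k u
  set S : ℝ := ((observedCount h k u : ℕ) : ℝ)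
  set w := Real.sqrt (6 * τmax * L / Φ)
  have hw : Real.sqrt (6 * (P.tau k u * Φ) * L) ≤ Φ * w := by
    rw [show Φ * w = Real.sqrt (Φ ^ 2 * (6 * τmax * L / Φ)) by
      rw [Real.sqrt_mul (sq_nonneg Φ), Real.sqrt_sq hΦ.le]]
    refine Real.sqrt_le_sqrt ?_
    rw [show Φ ^ 2 * (6 * τmax * L / Φ) = 6 * (τmax * Φ) * L by field_simp]
    have := mul_le_mul_of_nonneg_right (hτ k u) hΦ.le
    exact mul_le_mul_of_nonneg_right (by linarith) hL
  have e : S / Φ + 2 * L / Φ + w = (S + 2 * L + Φ * w) / Φ := by field_simp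
  constructor
  · rw [e, le_div_iff₀ hΦ]
    linarith [hd.1]
  · rw [e, show 12 * (L / Φ) + 2 * w = (12 * L + 2 * (Φ * w)) / Φ by field_simp, sub_le_iff_le_add,
      div_le_iff₀ hΦ, add_mul, div_mul_cancel₀ _ hΦ.ne']
    linarith [hd.2]

theorem exists_pair_appliedScaling_le {τmax : ℝ} (hτ : ∀ k u, P.tau k u ≤ τmax) {h : History K U}
    (hΦ : ∀ k u, 0 < appliedScaling P.scaling h k u)
    (hd : ∀ k u, ¬ Deviates (Real.log ((h.length + 1 : ℕ) : ℝ)) (observedCount h k u)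
      (P.compensator h k u)) {a : SearchAction K U}
    (ha : ∀ b, pairReward (ucbIndex P.scaling τmax h) P.scaling b
      ≤ pairReward (ucbIndex P.scaling τmax h) P.scaling a) (hgap : 0 < P.gap a) :
    ∃ k u, a.1 k = some u ∧ appliedScaling P.scaling h k u * P.gap a ^ 2
      ≤ 24 * ((K : ℝ) * U) ^ 2 * τmax * Real.log ((h.length + 1 : ℕ) : ℝ) := by
  by_contra! hcon
  have hL : 0 ≤ Real.log ((h.length + 1 : ℕ) : ℝ) := Real.log_natCast_nonneg _
  set L := Real.log ((h.length + 1 : ℕ) : ℝ)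
  set idx := ucbIndex P.scaling τmax h
  set N := (K : ℝ) * U
  set W := P.weight a
  have hW0 : 0 ≤ W := P.weight_nonneg a
  have hWN : W ≤ N := P.weight_le a
  have hmul := P.gap_le_mul hτ a
  have hτ0 : 0 < τmax := by
    by_contra hneg
    have := mul_nonneg (neg_nonneg.2 (not_lt.1 hneg)) (sub_nonneg.2 hWN)
    linarith
  have hN : 0 < N := by
    by_contra hneg
    have := mul_nonneg hτ0.le (show 0 ≤ W - N by linarith)
    linarith
  -- For every pair of `a`, the negated claim says `6 τmax L / Φ < D²`: the square root is at most
  -- `D`, and `12 L / Φ < 2 D² / τmax`.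
  set D := P.gap a / (2 * N) with hD
  have hgD : P.gap a = 2 * N * D := by rw [hD]; field_simp
  have hD0 : 0 < D := by positivity
  set B := 2 * (D + D ^ 2 / τmax) with hB
  have hbound : ∀ k u, a.1 k = some u → idx k u - P.tau k u < B := by
    intro k u hku
    have h1 := (P.tau_le_ucbIndex hτ (hΦ k u) (hd k u)).2
    have h2 := hcon k u hku
    have h3 : 6 * τmax * L / appliedScaling P.scaling h k u < D ^ 2 := by
      rw [div_lt_iff₀ (hΦ k u)]
      rw [hgD] at h2
      have h4 : 4 * N ^ 2 * (6 * τmax * L)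
          < 4 * N ^ 2 * (D ^ 2 * appliedScaling P.scaling h k u) := by linarith
      exact lt_of_mul_lt_mul_left h4 (by positivity)
    have h4 : Real.sqrt (6 * τmax * L / appliedScaling P.scaling h k u) ≤ D :=
      Real.sqrt_le_iff.2 ⟨hD0.le, h3.le⟩
    have h5 : 6 * (L / appliedScaling P.scaling h k u) < D ^ 2 / τmax := by
      rw [lt_div_iff₀ hτ0]
      calc _ = 6 * τmax * L / appliedScaling P.scaling h k u := by ring
        _ < _ := h3
    rw [hB]
    linarith
  obtain ⟨b, hb⟩ := P.exists_reward_eq_opt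
  have hopt : P.opt ≤ pairReward idx P.scaling b := by
    rw [← hb, P.reward_eq_pairReward, pairReward_eq, pairReward_eq]
    refine Finset.sum_le_sum fun p _ => ?_
    split_ifs
    · exact mul_le_mul_of_nonneg_left (P.tau_le_ucbIndex hτ (hΦ _ _) (hd _ _)).1
        (P.scaling_nonneg _ _)
    · exact le_rfl
  have hle : P.gap a ≤ ∑ p : Fin K × Fin U,
      if a.1 p.1 = some p.2 then P.scaling p.2 a * (idx p.1 p.2 - P.tau p.1 p.2) else 0 := by
    have := hopt.trans (ha b)
    calc P.gap a ≤ pairReward idx P.scaling a - pairReward P.tau P.scaling a := by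
          rw [gap, P.reward_eq_pairReward]; linarith
      _ = _ := by
          rw [pairReward_eq, pairReward_eq, ← Finset.sum_sub_distrib]
          refine Finset.sum_congr rfl fun p _ => ?_
          split_ifs <;> ring
  have hex : ∃ p : Fin K × Fin U, a.1 p.1 = some p.2 := by
    by_contra! hno
    rw [Finset.sum_eq_zero fun p _ => if_neg (hno p)] at hle
    linarith
  obtain ⟨q, hq⟩ := hex
  have hlt : P.gap a < W * B := by
    refine hle.trans_lt ?_
    rw [show W = P.weight a from rfl, weight, Finset.sum_mul]
    refine Finset.sum_lt_sum (fun p _ => ?_) ⟨q, Finset.mem_univ _, ?_⟩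
    · split_ifs with hp
      · exact mul_le_mul_of_nonneg_left (hbound _ _ hp).le (P.scaling_nonneg _ _)
      · rw [zero_mul]
    · rw [if_pos hq, if_pos hq]
      exact mul_lt_mul_of_pos_left (hbound _ _ hq) (P.scaling_pos _ _ _ hq)
  set x := D / τmax with hx
  have hxD : D ^ 2 / τmax = D * x := by rw [hx]; ring
  have hx1 : 2 * N * x ≤ N - W := by
    rw [hx, show 2 * N * (D / τmax) = P.gap a / τmax by rw [hgD]; ring, div_le_iff₀ hτ0]
    linarith
  -- The linear term inflates the error by the factor `1 + x`. By `gap_le_mul`, `x` is at most `(N -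
  -- W) / (2N)`, so the unused weight `N - W` pays for it.
  have hfin : W * (1 + x) ≤ N := by
    have h1 := mul_le_mul_of_nonneg_left hx1 hW0
    have h2 := mul_nonneg (sub_nonneg.2 hWN) (show 0 ≤ 2 * N - W by linarith)
    have h3 : 2 * N * (W * (1 + x)) ≤ 2 * N * N := by nlinarith
    exact le_of_mul_le_mul_left h3 (by positivity)
  have := mul_le_mul_of_nonneg_left hfin hD0.le
  rw [hB, hxD, hgD] at hlt
  nlinarith

theorem scalingMin_le {a : SearchAction K U} {k : Fin K} {u : Fin U} (h : a.1 k = some u) :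
    P.scalingMin k u ≤ P.scaling u a :=
  ciInf_le (Set.finite_range fun a : {a : SearchAction K U // a.1 k = some u} =>
    P.scaling u a.1).bddBelow ⟨a, h⟩

theorem scalingMin_pos (k : Fin K) (u : Fin U) : 0 < P.scalingMin k u := by
  have : Nonempty {a : SearchAction K U // a.1 k = some u} :=
    ⟨⟨singleAction k u, singleAction_apply k u⟩⟩
  obtain ⟨a, ha⟩ := exists_eq_ciInf_of_finite
    (f := fun a : {a : SearchAction K U // a.1 k = some u} => P.scaling u a.1)
  rw [scalingMin, ← ha]
  exact P.scaling_pos u a.1 k a.2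

theorem gap_le_gapMax {a : SearchAction K U} {k : Fin K} {u : Fin U}
    (ha : a ∈ P.suboptimal k u) : P.gap a ≤ P.gapMax k u :=
  le_ciSup (Set.finite_range fun a : P.suboptimal k u => P.opt - P.reward a).bddAbove ⟨a, ha⟩

theorem gapMin_le_gap {a : SearchAction K U} {k : Fin K} {u : Fin U}
    (ha : a ∈ P.suboptimal k u) : P.gapMin k u ≤ P.gap a :=
  ciInf_le (Set.finite_range fun a : P.suboptimal k u => P.opt - P.reward a).bddBelow ⟨a, ha⟩

theorem gap_pos {a : SearchAction K U} (ha : P.reward a ≠ P.opt) : 0 < P.gap a :=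
  lt_of_le_of_ne (P.gap_nonneg a) fun h => ha (by rw [gap] at h; linarith)

theorem gapMin_pos {a : SearchAction K U} {k : Fin K} {u : Fin U}
    (ha : a ∈ P.suboptimal k u) : 0 < P.gapMin k u := by
  have : Nonempty (P.suboptimal k u) := ⟨⟨a, ha⟩⟩
  obtain ⟨b, hb⟩ := exists_eq_ciInf_of_finite
    (f := fun a : P.suboptimal k u => P.opt - P.reward a)
  rw [gapMin, ← hb]
  exact P.gap_pos b.2.1

theorem gapMin_le_gapMax (k : Fin K) (u : Fin U) : P.gapMin k u ≤ P.gapMax k u := by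
  rcases isEmpty_or_nonempty (P.suboptimal k u) with h | ⟨⟨a, ha⟩⟩
  · rw [gapMin, gapMax, Real.iInf_of_isEmpty, Real.iSup_of_isEmpty]
  · exact (P.gapMin_le_gap ha).trans (P.gap_le_gapMax ha)

theorem gapMax_nonneg (k : Fin K) (u : Fin U) : 0 ≤ P.gapMax k u :=
  Real.iSup_nonneg fun a => P.gap_nonneg a

theorem gapMaxAll_nonneg : 0 ≤ P.gapMaxAll := Real.iSup_nonneg fun p => P.gapMax_nonneg p.1 p.2

theorem gap_le_gapMaxAll {a : SearchAction K U} {k : Fin K} {u : Fin U} (h : a.1 k = some u) :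
    P.gap a ≤ P.gapMaxAll := by
  by_cases ha : P.reward a = P.opt
  · rw [gap, ha, sub_self]
    exact P.gapMaxAll_nonneg
  · exact (P.gap_le_gapMax ⟨ha, h⟩).trans
      (le_ciSup (Set.finite_range fun p : Fin K × Fin U => P.gapMax p.1 p.2).bddAbove (k, u))

variable {P} {τmax : ℝ} {e : Fin (K * U) ≃ Fin K × Fin U} {π : Policy K U}

theorem scalingMin_le_appliedScaling (hπ : IsFPCUCB P.scaling τmax e π) {h : History K U}
    (hh : History.FollowedBy π h) {k : Fin K} {u : Fin U}
    (hi : (e.symm (k, u) : ℕ) < h.length) :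
    P.scalingMin k u ≤ appliedScaling P.scaling h k u := by
  induction h with
  | nil => simp at hi
  | cons x h ih =>
    rw [appliedScaling_cons]
    rcases Nat.lt_succ_iff_lt_or_eq.1 hi with hlt | heq
    · have := ih hh.2 hlt
      split_ifs
      · linarith [P.scaling_nonneg u x.1]
      · linarith
    · have hlen : h.length < K * U := heq ▸ (e.symm (k, u)).2
      have hinit := hπ.init h hlen
      have : (⟨h.length, hlen⟩ : Fin (K * U)) = e.symm (k, u) := Fin.ext heq.symm
      rw [this, e.apply_symm_apply, ← hh.1] at hinit
      rw [if_pos hinit]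
      linarith [P.scalingMin_le hinit, P.appliedScaling_nonneg h k u]

theorem scalingMin_le_appliedScaling_of_le (hπ : IsFPCUCB P.scaling τmax e π) {h : History K U}
    (hh : History.FollowedBy π h) (hlen : K * U ≤ h.length) (k : Fin K) (u : Fin U) :
    P.scalingMin k u ≤ appliedScaling P.scaling h k u :=
  scalingMin_le_appliedScaling hπ hh ((e.symm (k, u)).2.trans_le hlen)

/-- `Δ_max` does not cover the empty action, which must therefore be ruled out. After the initial
rounds all indices are positive, so searching a single cell beats searching none. -/
theorem exists_searched (hπ : IsFPCUCB P.scaling τmax e π) (hKU : 0 < K * U) {h : History K U}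
    (hh : History.FollowedBy π h) : ∃ k u, (π h).1 k = some u := by
  rcases lt_or_ge h.length (K * U) with hlen | hlen
  · exact ⟨_, _, hπ.init h hlen⟩
  · have hK : 0 < K := Nat.pos_of_mul_pos_right hKU
    have hU : 0 < U := Nat.pos_of_mul_pos_left hKU
    by_contra! hno
    have h0 : pairReward (ucbIndex P.scaling τmax h) P.scaling (π h) = 0 := by
      rw [pairReward_eq]
      exact Finset.sum_eq_zero fun p _ => if_neg (hno p.1 p.2)
    have hΦ : ∀ k u, 0 < appliedScaling P.scaling h k u := fun k u =>
      (P.scalingMin_pos k u).trans_le (scalingMin_le_appliedScaling_of_le hπ hh hlen k u)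
    have hL : 0 < Real.log ((h.length + 1 : ℕ) : ℝ) :=
      Real.log_pos (by exact_mod_cast (by omega : 1 < h.length + 1))
    have hI : ∀ k u, 0 < ucbIndex P.scaling τmax h k u := fun k u => by
      have := hΦ k u
      unfold ucbIndex
      positivity
    have hle := hπ.iter h hlen (singleAction ⟨0, hK⟩ ⟨0, hU⟩)
    rw [h0, pairReward_eq] at hle
    refine absurd hle (not_le.2 (Finset.sum_pos' (fun p _ => ?_)
      ⟨(⟨0, hK⟩, ⟨0, hU⟩), Finset.mem_univ _, ?_⟩))
    · split_ifs
      · exact mul_nonneg (P.scaling_nonneg _ _) (hI _ _).le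
      · exact le_rfl
    · rw [if_pos (singleAction_apply _ _)]
      exact mul_pos (P.scaling_pos _ _ _ (singleAction_apply _ _)) (hI _ _)

theorem gap_policy_le (hπ : IsFPCUCB P.scaling τmax e π) (hKU : 0 < K * U) {h : History K U}
    (hh : History.FollowedBy π h) : P.gap (π h) ≤ P.gapMaxAll := by
  obtain ⟨k, u, hku⟩ := exists_searched hπ hKU hh
  exact P.gap_le_gapMaxAll hku

/-- If `KU = 1`, the only action that searches a cell is optimal; if `KU = 0`, all rewards vanish.
-/
theorem gap_policy_eq_zero (hτ : ∀ k u, P.tau k u ≤ τmax) (hπ : IsFPCUCB P.scaling τmax e π)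
    (hKU : K * U ≤ 1) {h : History K U} (hh : History.FollowedBy π h) : P.gap (π h) = 0 := by
  rcases Nat.eq_zero_or_pos (K * U) with h0 | hpos
  · have h1 := P.gap_le_mul hτ (π h)
    have h2 := P.weight_le (π h)
    have h3 := P.weight_nonneg (π h)
    have h4 : (K : ℝ) * U = 0 := by exact_mod_cast h0
    have h5 : (K : ℝ) * U - P.weight (π h) = 0 := by linarith
    rw [h5, mul_zero] at h1
    exact le_antisymm h1 (P.gap_nonneg _)
  · obtain ⟨k, u, hku⟩ := exists_searched hπ hpos hh
    obtain ⟨rfl, rfl⟩ : K = 1 ∧ U = 1 := mul_eq_one.1 (by omega)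
    obtain ⟨b, hb⟩ := P.exists_reward_eq_opt
    refine le_antisymm ?_ (P.gap_nonneg _)
    rw [gap, ← hb, sub_nonpos]
    by_cases hbk : b.1 k = some u
    · have : b = π h := Subtype.ext (funext fun j => by rw [Subsingleton.elim j k, hbk, hku])
      rw [this]
    · rw [P.reward_eq_pairReward, P.reward_eq_pairReward, pairReward_eq, pairReward_eq]
      refine Finset.sum_le_sum fun p _ => ?_
      rw [if_neg (by rw [Subsingleton.elim p.1 k, Subsingleton.elim p.2 u]; exact hbk)]
      split_ifs
      · exact mul_nonneg (P.scaling_nonneg _ _) (P.tau_nonneg _ _)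
      · exact le_rfl

end SearchProblem

/-! ### Charging the gaps to cell-searcher pairs. -/

namespace SearchProblem

variable (P : SearchProblem K U)

/-- The total gap of the actions of a history. -/
noncomputable def gapSum (h : History K U) : ℝ := (h.map fun x => P.gap x.1).sum

open Classical in
/-- The number of rounds after the first `KU` ones in which the count of some pair deviates from
its mean. -/
noncomputable def deviationCount : History K U → ℕ
  | [] => 0
  | _ :: h => deviationCount h +
      if K * U ≤ h.length ∧ ∃ k u, Deviates (Real.log ((h.length + 1 : ℕ) : ℝ))
        (observedCount h k u) (P.compensator h k u) then 1 else 0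

/-- A suboptimal action is charged to a pair if the total scaling applied to the pair is small. -/
def Charged (ℓ : ℝ) (k : Fin K) (u : Fin U) (h : History K U) (a : SearchAction K U) : Prop :=
  K * U ≤ h.length ∧ a ∈ P.suboptimal k u ∧ appliedScaling P.scaling h k u * P.gap a ^ 2 ≤ ℓ

open Classical in
/-- The number of actions charged to a pair. -/
noncomputable def chargeCount (ℓ : ℝ) (k : Fin K) (u : Fin U) : History K U → ℕ
  | [] => 0
  | x :: h => chargeCount ℓ k u h + if P.Charged ℓ k u h x.1 then 1 else 0

open Classical in
/-- The total gap of the actions charged to a pair. -/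
noncomputable def chargeSum (ℓ : ℝ) (k : Fin K) (u : Fin U) : History K U → ℝ
  | [] => 0
  | x :: h => chargeSum ℓ k u h + if P.Charged ℓ k u h x.1 then P.gap x.1 else 0

theorem chargeSum_eq_zero {ℓ : ℝ} {k : Fin K} {u : Fin U} (hmin : ¬ 0 < P.gapMin k u)
    (h : History K U) : P.chargeSum ℓ k u h = 0 := by
  induction h with
  | nil => rfl
  | cons x h ih =>
    rw [chargeSum, ih, if_neg fun hc => hmin (P.gapMin_pos hc.2.1), add_zero]

variable {P} {τmax : ℝ} {e : Fin (K * U) ≃ Fin K × Fin U} {π : Policy K U}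

/-- The `+ 1` is the uncharged visit to the pair in the initial rounds. -/
theorem scalingMin_mul_chargeCount_le (hπ : IsFPCUCB P.scaling τmax e π) (ℓ : ℝ) (k : Fin K)
    (u : Fin U) {h : History K U} (hh : History.FollowedBy π h) :
    (h.length ≤ K * U → P.chargeCount ℓ k u h = 0) ∧
      (K * U ≤ h.length → P.scalingMin k u * (P.chargeCount ℓ k u h + 1)
        ≤ appliedScaling P.scaling h k u) := by
  have key : ∀ h, History.FollowedBy π h → h.length ≤ K * U → P.chargeCount ℓ k u h = 0 := by
    intro h
    induction h with
    | nil => intro _ _; rfl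
    | cons x h ih =>
      intro hh hlen
      rw [List.length_cons] at hlen
      rw [chargeCount, ih hh.2 (by omega), if_neg fun hc => by have := hc.1; omega]
  refine ⟨key h hh, fun hlen => ?_⟩
  induction h with
  | nil =>
    rw [key _ hh (Nat.zero_le _)]
    simpa using scalingMin_le_appliedScaling_of_le hπ hh hlen k u
  | cons x h ih =>
    rcases hlen.eq_or_lt with heq | hlt
    · rw [key _ hh heq.ge]
      simpa using scalingMin_le_appliedScaling_of_le hπ hh hlen k u
    · have ih' := ih hh.2 (by rw [List.length_cons] at hlt; omega)
      rw [chargeCount, appliedScaling_cons]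
      by_cases hc : P.Charged ℓ k u h x.1
      · rw [if_pos hc, if_pos hc.2.1.2]
        have := P.scalingMin_le hc.2.1.2
        push_cast
        linarith
      · rw [if_neg hc, add_zero]
        split_ifs
        · linarith [P.scaling_nonneg u x.1]
        · linarith

/-- If the `j`-th charge has gap `Δ_j`, then `j Δ_j² ≤ c`, so at most `c / x²` charges have gap at
least `x`. Integrating over `x` from `Δ_min` to `Δ_max` gives `c / Δ_min - c / Δ_max`, and the part
of the gaps below `Δ_min` adds at most `c / Δ_min`. -/
theorem chargeSum_le (hπ : IsFPCUCB P.scaling τmax e π) {ℓ : ℝ} (hℓ : 0 ≤ ℓ) (k : Fin K)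
    (u : Fin U) (hmin : 0 < P.gapMin k u) {h : History K U} (hh : History.FollowedBy π h) :
    P.chargeSum ℓ k u h
      ≤ ℓ / P.scalingMin k u * (2 / P.gapMin k u - 1 / P.gapMax k u) := by
  have hφ := P.scalingMin_pos k u
  set c := ℓ / P.scalingMin k u with hc
  have hc0 : 0 ≤ c := by positivity
  have hmm := P.gapMin_le_gapMax k u
  have hmax : 0 < P.gapMax k u := hmin.trans_le hmm
  have hcharge : ∀ (h : History K U) (a : SearchAction K U), History.FollowedBy π h →
      P.Charged ℓ k u h a → (P.chargeCount ℓ k u h + 1 : ℝ) * P.gap a ^ 2 ≤ c := by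
    intro h a hh hch
    rw [hc, le_div_iff₀ hφ]
    have h1 := (scalingMin_mul_chargeCount_le hπ ℓ k u hh).2 hch.1
    have h2 := mul_le_mul_of_nonneg_right h1 (sq_nonneg (P.gap a))
    linarith [hch.2.2]
  -- The level `g` stays free in the induction: when a new gap `Δ` exceeds it, the hypothesis is
  -- applied at level `Δ`.
  have hsum : ∀ h : History K U, History.FollowedBy π h → ∀ g, P.gapMin k u ≤ g →
      g ≤ P.gapMax k u →
      P.chargeSum ℓ k u h ≤ g * P.chargeCount ℓ k u h + (c / g - c / P.gapMax k u) := by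
    intro h
    induction h with
    | nil =>
      intro _ g hg hg'
      simp only [chargeSum, chargeCount, Nat.cast_zero, mul_zero, zero_add, sub_nonneg]
      exact div_le_div_of_nonneg_left hc0 (hmin.trans_le hg) hg'
    | cons x h ih =>
      intro hh g hg hg'
      have hg0 : 0 < g := hmin.trans_le hg
      rw [chargeSum, chargeCount]
      by_cases hch : P.Charged ℓ k u h x.1
      · rw [if_pos hch, if_pos hch]
        push_cast
        rcases le_or_gt (P.gap x.1) g with hle | hlt
        · have := ih hh.2 g hg hg'
          linarith
        · set Δ := P.gap x.1
          have hΔ : 0 < Δ := hg0.trans hlt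
          have h1 := ih hh.2 Δ (hg.trans hlt.le) (P.gap_le_gapMax hch.2.1)
          have h2 := hcharge h x.1 hh.2 hch
          have h3 : (Δ - g) * (P.chargeCount ℓ k u h + 1) ≤ c / g - c / Δ := by
            rw [show c / g - c / Δ = (Δ - g) * (c / (g * Δ)) by field_simp]
            refine mul_le_mul_of_nonneg_left ?_ (by linarith)
            rw [le_div_iff₀ (by positivity)]
            refine le_trans (mul_le_mul_of_nonneg_left ?_ (by positivity)) h2
            nlinarith
          linarith
      · rw [if_neg hch, if_neg hch, add_zero, add_zero]
        exact ih hh.2 g hg hg'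
  have hcount : ∀ h : History K U, History.FollowedBy π h →
      (P.chargeCount ℓ k u h : ℝ) * P.gapMin k u ^ 2 ≤ c := by
    intro h
    induction h with
    | nil => intro _; simpa [chargeCount] using hc0
    | cons x h ih =>
      intro hh
      rw [chargeCount]
      by_cases hch : P.Charged ℓ k u h x.1
      · rw [if_pos hch]
        push_cast
        refine le_trans (mul_le_mul_of_nonneg_left ?_ (by positivity)) (hcharge h x.1 hh.2 hch)
        exact pow_le_pow_left₀ hmin.le (P.gapMin_le_gap hch.2.1) 2
      · rw [if_neg hch, add_zero]
        exact ih hh.2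
  have h1 := hsum h hh (P.gapMin k u) le_rfl hmm
  have h2 : P.gapMin k u * P.chargeCount ℓ k u h ≤ c / P.gapMin k u := by
    rw [le_div_iff₀ hmin]
    linarith [hcount h hh]
  calc P.chargeSum ℓ k u h ≤ c / P.gapMin k u + (c / P.gapMin k u - c / P.gapMax k u) := by
        linarith
    _ = _ := by ring

theorem gapSum_le (hτ : ∀ k u, P.tau k u ≤ τmax) (hπ : IsFPCUCB P.scaling τmax e π)
    (hτ0 : 0 ≤ τmax) (hKU : 0 < K * U) {n : ℕ} {h : History K U} (hh : History.FollowedBy π h)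
    (hlen : h.length ≤ n) :
    P.gapSum h ≤ (min h.length (K * U) : ℕ) * P.gapMaxAll
      + P.gapMaxAll * P.deviationCount h
      + ∑ p : Fin K × Fin U,
          P.chargeSum (24 * ((K : ℝ) * U) ^ 2 * τmax * Real.log n) p.1 p.2 h := by
  set ℓ := 24 * ((K : ℝ) * U) ^ 2 * τmax * Real.log n with hℓ
  induction h with
  | nil => simp [gapSum, deviationCount, chargeSum]
  | cons x h ih =>
    have hΔ := P.gapMaxAll_nonneg
    have ih' := ih hh.2 (by rw [List.length_cons] at hlen; omega)
    have hgs : P.gapSum (x :: h) = P.gap x.1 + P.gapSum h := by simp [gapSum]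
    have hgap : P.gap x.1 ≤ P.gapMaxAll := hh.1 ▸ gap_policy_le hπ hKU hh.2
    have hstep : ∀ k u, P.chargeSum ℓ k u h ≤ P.chargeSum ℓ k u (x :: h) := fun k u => by
      rw [chargeSum]
      split_ifs
      · linarith [P.gap_nonneg x.1]
      · linarith
    have hsteps : ∑ p : Fin K × Fin U, P.chargeSum ℓ p.1 p.2 h
        ≤ ∑ p : Fin K × Fin U, P.chargeSum ℓ p.1 p.2 (x :: h) :=
      Finset.sum_le_sum fun p _ => hstep p.1 p.2
    have hcnt : (P.deviationCount h : ℝ) ≤ P.deviationCount (x :: h) := by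
      rw [deviationCount]
      exact_mod_cast Nat.le_add_right _ _
    have hcnt' := mul_le_mul_of_nonneg_left hcnt hΔ
    rw [hgs, List.length_cons]
    rcases lt_or_ge h.length (K * U) with hlt | hge
    · rw [min_eq_left hlt.le] at ih'
      rw [min_eq_left (Nat.succ_le_of_lt hlt)]
      push_cast
      linarith
    · rw [min_eq_right hge] at ih'
      rw [min_eq_right (hge.trans (Nat.le_succ _))]
      by_cases hdev : ∃ k u, Deviates (Real.log ((h.length + 1 : ℕ) : ℝ))
          (observedCount h k u) (P.compensator h k u)
      · have : P.deviationCount (x :: h) = P.deviationCount h + 1 := by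
          rw [deviationCount, if_pos ⟨hge, hdev⟩]
        rw [this]
        push_cast at ih' ⊢
        linarith
      · rcases (P.gap_nonneg x.1).eq_or_lt with h0 | hpos
        · linarith
        · push Not at hdev
          rw [hh.1] at hpos
          obtain ⟨k, u, hku, hle⟩ := P.exists_pair_appliedScaling_le hτ
            (fun k u => (P.scalingMin_pos k u).trans_le
              (scalingMin_le_appliedScaling_of_le hπ hh.2 hge k u)) hdev
            (hπ.iter h hge) hpos
          rw [← hh.1] at hpos hku hle
          have hch : P.Charged ℓ k u h x.1 := by
            refine ⟨hge, ⟨fun heq => ?_, hku⟩, hle.trans ?_⟩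
            · rw [gap, heq, sub_self] at hpos
              exact lt_irrefl _ hpos
            · refine mul_le_mul_of_nonneg_left ?_ (by positivity)
              refine Real.log_le_log (by positivity) ?_
              rw [List.length_cons] at hlen
              exact_mod_cast hlen
          have hsum : P.gap x.1 + ∑ p : Fin K × Fin U, P.chargeSum ℓ p.1 p.2 h
              ≤ ∑ p : Fin K × Fin U, P.chargeSum ℓ p.1 p.2 (x :: h) := by
            have : P.gap x.1 = P.chargeSum ℓ k u (x :: h) - P.chargeSum ℓ k u h := by
              rw [chargeSum, if_pos hch]; ring
            have h2 := Finset.single_le_sum (f := fun p : Fin K × Fin U =>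
              P.chargeSum ℓ p.1 p.2 (x :: h) - P.chargeSum ℓ p.1 p.2 h)
              (fun p _ => sub_nonneg.2 (hstep p.1 p.2)) (Finset.mem_univ (k, u))
            rw [Finset.sum_sub_distrib] at h2
            simp only at h2
            linarith
          linarith

end SearchProblem

/-! ### Comparison of the charges with the integral of `b̃(x) / x²`. -/

theorem bTilde_nonneg (K U : ℕ) (τ x : ℝ) : 0 ≤ bTilde K U τ x := by
  have h : |τ| ≤ Real.sqrt (τ ^ 2 + x ^ 2 / (9 * ((K : ℝ) * U) ^ 2)) :=
    Real.abs_le_sqrt (le_add_of_nonneg_right (by positivity))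
  unfold bTilde
  linarith [neg_abs_le τ]

theorem two_mul_le_bTilde (K U : ℕ) (τ x : ℝ) : 2 * τ ≤ bTilde K U τ x := by
  have h : |τ| ≤ Real.sqrt (τ ^ 2 + x ^ 2 / (9 * ((K : ℝ) * U) ^ 2)) :=
    Real.abs_le_sqrt (le_add_of_nonneg_right (by positivity))
  unfold bTilde
  linarith [le_abs_self τ]

theorem le_integral_bTilde (K U : ℕ) (τ : ℝ) {a b : ℝ} (ha : 0 < a) (hab : a ≤ b) :
    2 * τ * (1 / a - 1 / b) ≤ ∫ x in a..b, bTilde K U τ x / x ^ 2 := by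
  have hpos : ∀ x ∈ Set.uIcc a b, x ≠ 0 := fun x hx => by
    rw [Set.uIcc_of_le hab] at hx
    exact (ha.trans_le hx.1).ne'
  have hb : Continuous fun x => bTilde K U τ x := by
    unfold bTilde
    fun_prop
  have hc2 : ContinuousOn (fun x : ℝ => bTilde K U τ x / x ^ 2) (Set.uIcc a b) :=
    hb.continuousOn.div (by fun_prop) fun x hx => pow_ne_zero 2 (hpos x hx)
  have hc1 : ContinuousOn (fun x : ℝ => 2 * τ / x ^ 2) (Set.uIcc a b) :=
    continuousOn_const.div (by fun_prop) fun x hx => pow_ne_zero 2 (hpos x hx)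
  have hint : ∫ x in a..b, 2 * τ / x ^ 2 = 2 * τ * (1 / a - 1 / b) := by
    have hd : ∀ x ∈ Set.uIcc a b, HasDerivAt (fun x : ℝ => -(2 * τ) * x⁻¹) (2 * τ / x ^ 2) x := by
      intro x hx
      exact ((hasDerivAt_inv (hpos x hx)).const_mul (-(2 * τ))).congr_deriv (by ring)
    rw [intervalIntegral.integral_eq_sub_of_hasDerivAt hd hc1.intervalIntegrable]
    ring
  rw [← hint]
  refine intervalIntegral.integral_mono_on hab hc1.intervalIntegrable hc2.intervalIntegrable
    fun x _ => ?_
  exact div_le_div_of_nonneg_right (two_mul_le_bTilde K U τ x) (sq_nonneg x)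

namespace SearchProblem

variable {P : SearchProblem K U} {τmax : ℝ} {e : Fin (K * U) ≃ Fin K × Fin U} {π : Policy K U}

/-- Here `24 τmax = 12 · 2 τmax`, and `2 / Δ_min - 1 / Δ_max` is `1 / Δ_min` plus the integral of
`x⁻²`. -/
theorem charge_bound_le (k : Fin K) (u : Fin U) (hmin : 0 < P.gapMin k u)
    (n : ℕ) :
    24 * ((K : ℝ) * U) ^ 2 * τmax * Real.log n / P.scalingMin k u
        * (2 / P.gapMin k u - 1 / P.gapMax k u)
      ≤ 12 * ((K : ℝ) * U) ^ 2 / P.scalingMin k u *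
          (bTilde K U τmax (P.gapMin k u) / P.gapMin k u
            + ∫ x in (P.gapMin k u)..(P.gapMax k u), bTilde K U τmax x / x ^ 2) * Real.log n := by
  have hφ := P.scalingMin_pos k u
  have hlog : 0 ≤ Real.log n := Real.log_natCast_nonneg n
  have h1 := le_integral_bTilde K U τmax hmin (P.gapMin_le_gapMax k u)
  have h2 := div_le_div_of_nonneg_right (two_mul_le_bTilde K U τmax (P.gapMin k u)) hmin.le
  calc _ = 12 * ((K : ℝ) * U) ^ 2 / P.scalingMin k u *
          (2 * τmax / P.gapMin k u + 2 * τmax * (1 / P.gapMin k u - 1 / P.gapMax k u))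
            * Real.log n := by ring
    _ ≤ _ := by gcongr

theorem sum_chargeSum_le (hπ : IsFPCUCB P.scaling τmax e π) (hτ0 : 0 ≤ τmax) (n : ℕ)
    {h : History K U} (hh : History.FollowedBy π h) :
    ∑ p : Fin K × Fin U, P.chargeSum (24 * ((K : ℝ) * U) ^ 2 * τmax * Real.log n) p.1 p.2 h
      ≤ ∑ p : Fin K × Fin U with 0 < P.gapMin p.1 p.2,
        12 * ((K : ℝ) * U) ^ 2 / P.scalingMin p.1 p.2 *
          (bTilde K U τmax (P.gapMin p.1 p.2) / P.gapMin p.1 p.2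
            + ∫ x in (P.gapMin p.1 p.2)..(P.gapMax p.1 p.2), bTilde K U τmax x / x ^ 2)
          * Real.log n := by
  have hlog : 0 ≤ Real.log n := Real.log_natCast_nonneg n
  rw [Finset.sum_filter]
  refine Finset.sum_le_sum fun p _ => ?_
  split_ifs with hmin
  · exact (chargeSum_le hπ (by positivity) p.1 p.2 hmin hh).trans
      (charge_bound_le p.1 p.2 hmin n)
  · exact (P.chargeSum_eq_zero hmin h).le

/-! ### Passage to expectations and the final bound. -/

variable (P) in
theorem regret_le_of_expect_gapSum_le (π : Policy K U) (n : ℕ) {B : ℝ} (hB : 0 ≤ B)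
    (h : ((P.historyLaw π n).expect fun h => ENNReal.ofReal (P.gapSum h)) ≤ ENNReal.ofReal B) :
    P.regret π n ≤ B := by
  have hg0 : ∀ h, 0 ≤ P.gapSum h := fun h => List.sum_nonneg fun x hx => by
    obtain ⟨y, -, rfl⟩ := List.mem_map.1 hx
    exact P.gap_nonneg y.1
  have hne : ((P.historyLaw π n).expect fun h => ENNReal.ofReal (P.gapSum h)) ≠ ⊤ :=
    (h.trans_lt ENNReal.ofReal_lt_top).ne
  have hterm : ∀ x, (P.historyLaw π n x * ENNReal.ofReal (P.gapSum x)).toReal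
      = (P.historyLaw π n x).toReal * P.gapSum x := fun x => by
    rw [ENNReal.toReal_mul, ENNReal.toReal_ofReal (hg0 x)]
  -- A real series that is not summable has the value 0 by default; summability comes from the
  -- finite expectation in `[0, ∞]`.
  have hsum : Summable fun x => (P.historyLaw π n x).toReal * P.gapSum x := by
    have := ENNReal.summable_toReal hne
    simpa only [hterm] using this
  have hp : HasSum (fun x => (P.historyLaw π n x).toReal) 1 := by
    have h1 := (P.historyLaw π n).tsum_coe
    have h2 : Summable fun x => (P.historyLaw π n x).toReal :=
      ENNReal.summable_toReal (by rw [h1]; exact ENNReal.one_ne_top)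
    have h3 := ENNReal.tsum_toReal_eq fun x => (P.historyLaw π n).apply_ne_top x
    rw [h1, ENNReal.toReal_one] at h3
    rw [h3]
    exact h2.hasSum
  have hlist : ∀ x : History K U,
      (x.map fun y => P.reward y.1).sum = x.length * P.opt - P.gapSum x := by
    intro x
    induction x with
    | nil => simp [gapSum]
    | cons y x ih =>
      simp only [gapSum, List.map_cons, List.sum_cons, List.length_cons, gap] at ih ⊢
      rw [ih]
      push_cast
      ring
  have hexp : P.expectedReward π n
      = n * P.opt - ∑' x, (P.historyLaw π n x).toReal * P.gapSum x := by
    have h4 := (hp.mul_right (n * P.opt)).sub hsum.hasSum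
    rw [one_mul] at h4
    rw [← h4.tsum_eq, expectedReward]
    refine tsum_congr fun x => ?_
    by_cases hx : P.historyLaw π n x = 0
    · simp [hx]
    · rw [hlist, (P.historyLaw_support π n x hx).1]
      ring
  have hreg : P.regret π n
      = ((P.historyLaw π n).expect fun h => ENNReal.ofReal (P.gapSum h)).toReal := by
    rw [regret, hexp, PMF.expect, ENNReal.tsum_toReal_eq fun x =>
      ENNReal.mul_ne_top ((P.historyLaw π n).apply_ne_top x) ENNReal.ofReal_ne_top]
    simp only [hterm]
    ring
  rw [hreg]
  exact ENNReal.toReal_le_of_le_ofReal hB h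

variable (P) in
theorem expect_deviationCount_le (π : Policy K U) (hKU : 0 < K * U) (n : ℕ) :
    ((P.historyLaw π n).expect fun h => (P.deviationCount h : ℝ≥0∞))
      ≤ ENNReal.ofReal (((K : ℝ) * U)
          * ∑ t ∈ Finset.Ico (K * U) n, 3.45 * ((t + 1 : ℕ) : ℝ) ^ (-(5 / 3) : ℝ)) := by
  classical
  induction n with
  | zero =>
    rw [historyLaw, PMF.expect_pure]
    simp [deviationCount]
  | succ n ih =>
    rw [historyLaw_expect_succ]
    have hcons : ∀ (x : SearchAction K U × (Fin K → ℕ)) (h : History K U),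
        (P.deviationCount (x :: h) : ℝ≥0∞) = P.deviationCount h
          + ((if K * U ≤ h.length ∧ ∃ k u, Deviates (Real.log ((h.length + 1 : ℕ) : ℝ))
            (observedCount h k u) (P.compensator h k u) then 1 else 0 : ℕ) : ℝ≥0∞) :=
      fun x h => by rw [deviationCount, Nat.cast_add]
    simp only [hcons, PMF.expect_const]
    rw [PMF.expect_add]
    rcases lt_or_ge n (K * U) with hlt | hge
    · rw [Finset.Ico_eq_empty_of_le hlt.le] at ih
      rw [Finset.Ico_eq_empty_of_le hlt]
      have h0 : ((P.historyLaw π n).expect fun h => ((if K * U ≤ h.length ∧ ∃ k u,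
          Deviates (Real.log ((h.length + 1 : ℕ) : ℝ)) (observedCount h k u)
            (P.compensator h k u) then 1 else 0 : ℕ) : ℝ≥0∞))
          ≤ (P.historyLaw π n).expect fun _ => 0 :=
        PMF.expect_mono _ fun h hh => by
          rw [if_neg fun hc => by
            have := (P.historyLaw_support π n h hh).1
            omega]
          simp
      rw [PMF.expect_const] at h0
      exact (add_le_add ih h0).trans (by rw [add_zero])
    · rw [Finset.sum_Ico_succ_top hge, mul_add,
        ENNReal.ofReal_add (by positivity) (by positivity)]
      refine add_le_add ih ?_
      have hL : 0 < Real.log ((n + 1 : ℕ) : ℝ) :=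
        Real.log_pos (by exact_mod_cast (by omega : 1 < n + 1))
      calc _ ≤ (P.historyLaw π n).expect fun h => ∑ p : Fin K × Fin U,
              if Deviates (Real.log ((n + 1 : ℕ) : ℝ)) (observedCount h p.1 p.2)
                (P.compensator h p.1 p.2) then 1 else 0 := by
            refine PMF.expect_mono _ fun h hh => ?_
            rw [(P.historyLaw_support π n h hh).1]
            split_ifs with hd
            · obtain ⟨-, k, u, hku⟩ := hd
              have := Finset.single_le_sum (f := fun p : Fin K × Fin U =>
                if Deviates (Real.log ((n + 1 : ℕ) : ℝ)) (observedCount h p.1 p.2)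
                  (P.compensator h p.1 p.2) then (1 : ℝ≥0∞) else 0)
                (fun _ _ => zero_le) (Finset.mem_univ (k, u))
              simp only [hku, if_true] at this
              rw [Nat.cast_one]
              exact this
            · simp
        _ ≤ ∑ _p : Fin K × Fin U,
              ENNReal.ofReal (3.45 * ((n + 1 : ℕ) : ℝ) ^ (-(5 / 3) : ℝ)) := by
            rw [PMF.expect_finset_sum]
            exact Finset.sum_le_sum fun p _ =>
              (P.historyLaw_expect_deviates_le π p.1 p.2 n hL).trans
                (ENNReal.ofReal_le_ofReal (deviation_bound_le (n + 1) (Nat.le_add_left 1 n)))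
        _ = _ := by
            rw [Finset.sum_const, Finset.card_univ, Fintype.card_prod, Fintype.card_fin,
              Fintype.card_fin, nsmul_eq_mul, ← Nat.cast_mul,
              ENNReal.ofReal_mul (Nat.cast_nonneg _), ENNReal.ofReal_natCast]

end SearchProblem

theorem corollary1 {K U : ℕ} (P : SearchProblem K U) (τmax : ℝ)
    (hτ : ∀ k u, P.tau k u ≤ τmax) (e : Fin (K * U) ≃ Fin K × Fin U) (π : Policy K U)
    (hπ : IsFPCUCB P.scaling τmax e π) (n : ℕ) :
    P.regret π n ≤
      (∑ p : Fin K × Fin U with 0 < P.gapMin p.1 p.2,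
        12 * ((K : ℝ) * U) ^ 2 / P.scalingMin p.1 p.2 *
          (bTilde K U τmax (P.gapMin p.1 p.2) / P.gapMin p.1 p.2
            + ∫ x in (P.gapMin p.1 p.2)..(P.gapMax p.1 p.2), bTilde K U τmax x / x ^ 2)
          * Real.log n)
      + (Real.pi ^ 2 / 3 + 1) * ((K : ℝ) * U) * P.gapMaxAll := by
  set R := ∑ p : Fin K × Fin U with 0 < P.gapMin p.1 p.2,
        12 * ((K : ℝ) * U) ^ 2 / P.scalingMin p.1 p.2 *
          (bTilde K U τmax (P.gapMin p.1 p.2) / P.gapMin p.1 p.2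
            + ∫ x in (P.gapMin p.1 p.2)..(P.gapMax p.1 p.2), bTilde K U τmax x / x ^ 2)
          * Real.log n with hR
  have hΔ := P.gapMaxAll_nonneg
  have hR0 : 0 ≤ R := by
    refine Finset.sum_nonneg fun p hp => ?_
    have hmin := (Finset.mem_filter.1 hp).2
    have hint : 0 ≤ ∫ x in (P.gapMin p.1 p.2)..(P.gapMax p.1 p.2), bTilde K U τmax x / x ^ 2 :=
      intervalIntegral.integral_nonneg (P.gapMin_le_gapMax p.1 p.2) fun x _ =>
        div_nonneg (bTilde_nonneg K U τmax x) (sq_nonneg x)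
    have hb := bTilde_nonneg K U τmax (P.gapMin p.1 p.2)
    have hφ := P.scalingMin_pos p.1 p.2
    have hlog : 0 ≤ Real.log n := Real.log_natCast_nonneg n
    positivity
  refine P.regret_le_of_expect_gapSum_le π n (by positivity) ?_
  -- For `KU ≤ 1` no regret is incurred; otherwise the deviation series starts late enough for
  -- `sum_rpow_le`.
  rcases le_or_gt (K * U) 1 with hKU | hKU
  · have h0 : ∀ h : History K U, History.FollowedBy π h → P.gapSum h = 0 := by
      intro h
      induction h with
      | nil => intro _; rfl
      | cons x h ih =>
        intro hh
        have hx := SearchProblem.gap_policy_eq_zero hτ hπ hKU hh.2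
        rw [← hh.1] at hx
        have := ih hh.2
        simp only [SearchProblem.gapSum, List.map_cons, List.sum_cons] at this ⊢
        rw [hx, this, add_zero]
    refine (PMF.expect_mono _ (G := fun _ => 0) fun h hh => ?_).trans ?_
    · rw [h0 h (P.historyLaw_support π n h hh).2, ENNReal.ofReal_zero]
    · rw [PMF.expect_const]
      exact zero_le
  · have hpos : 0 < K * U := by omega
    have hK : 0 < K := Nat.pos_of_mul_pos_right hpos
    have hU : 0 < U := Nat.pos_of_mul_pos_left hpos
    have hτ0 : 0 ≤ τmax := (P.tau_nonneg ⟨0, hK⟩ ⟨0, hU⟩).trans (hτ _ _)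
    have hN : (0 : ℝ) ≤ (K : ℝ) * U := by positivity
    calc ((P.historyLaw π n).expect fun h => ENNReal.ofReal (P.gapSum h))
        ≤ (P.historyLaw π n).expect fun h =>
            ENNReal.ofReal ((K : ℝ) * U * P.gapMaxAll + R)
              + ENNReal.ofReal P.gapMaxAll * P.deviationCount h := by
          refine PMF.expect_mono _ fun h hh => ?_
          obtain ⟨hlen, hf⟩ := P.historyLaw_support π n h hh
          rw [← ENNReal.ofReal_natCast, ← ENNReal.ofReal_mul hΔ,
            ← ENNReal.ofReal_add (by positivity) (by positivity)]
          refine ENNReal.ofReal_le_ofReal ?_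
          have h1 := SearchProblem.gapSum_le hτ hπ hτ0 hpos hf hlen.le
          have h2 := SearchProblem.sum_chargeSum_le hπ hτ0 n hf
          rw [← hR] at h2
          have h3 : ((min h.length (K * U) : ℕ) : ℝ) ≤ (K : ℝ) * U := by
            exact_mod_cast min_le_right _ _
          have h4 := mul_le_mul_of_nonneg_right h3 hΔ
          linarith
      _ = ENNReal.ofReal ((K : ℝ) * U * P.gapMaxAll + R) + ENNReal.ofReal P.gapMaxAll
            * (P.historyLaw π n).expect fun h => (P.deviationCount h : ℝ≥0∞) := by
          rw [PMF.expect_add, PMF.expect_const, PMF.expect_const_mul]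
      _ ≤ ENNReal.ofReal ((K : ℝ) * U * P.gapMaxAll + R)
            + ENNReal.ofReal P.gapMaxAll * ENNReal.ofReal ((K : ℝ) * U * (Real.pi ^ 2 / 3)) := by
          gcongr
          refine (P.expect_deviationCount_le π hpos n).trans (ENNReal.ofReal_le_ofReal ?_)
          exact mul_le_mul_of_nonneg_left (sum_rpow_le _ _ (by omega)) hN
      _ = ENNReal.ofReal (R + (Real.pi ^ 2 / 3 + 1) * ((K : ℝ) * U) * P.gapMaxAll) := by
          rw [← ENNReal.ofReal_mul hΔ, ← ENNReal.ofReal_add (by positivity) (by positivity)]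
          congr 1
          ring
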